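/- Let $\mathbb T=[-\tfrac12,\tfrac12)$ with periodic boundary conditions, let $q_u\equiv 1$ be the uniform distribution on $\mathbb T$, and for $R\in(0,\pi]$ let $W_R(\theta)=(R-2\pi|\theta|)_+^2$, $\theta\in\mathbb T$, be the noisy Hegselmann–Krause kernel. For $K\ge 0$ and a Borel probability measure $q$ on $\mathbb T$ let $$\mathcal F_{K}(q)=\int_{\mathbb T}\log q\,dq-K\iint_{\mathbb T\times\mathbb T}W_R(\theta-\theta')\,dq(\theta)\,dq(\theta')\in(-\infty,\infty],$$ where the first term is $+\infty$ if $q$ has no density with respect to Lebesgue measure. The critical coupling $K_c(R)$ is the (necessarily unique) number $K_c>0$ such that $q_u$ is the unique global minimizer of $\mathcal F_K$ for $0\le K<K_c$, $q_u$ is a global minimizer of $\mathcal F_{K_c}$, and $\mathcal F_K$ has a global minimizer $q\ne q_u$ for every $K>K_c$. The phase transition is continuous if the global minimizer of $\mathcal F_{K_c}$ is unique and, for every family $(q_K)_{K>K_c}$ of global minimizers $q_K$ of $\mathcal F_K$, $\limsup_{K\downarrow K_c}\|q_K-q_u\|_{L^1}=0$; otherwise it is discontinuous. The linear stability threshold is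 $K_\#(R)=\bigl(2\max_{k}\widehat W_R(k)\bigr)^{-1}$, where $\widehat W_R(k)=\int_{\mathbb T}W_R(\theta)e^{-2\pi ik\theta}\,d\theta$ and the maximum is over the integers $k\ge1$ with $\widehat W_R(k)>0$. **Theorem 1.7.** The equation $R=\sin R\,(2-\cos R)$ has exactly one solution $R_*$ in $(0,\pi)$, and for every $R\in(0,\pi]$ both $K_c(R)$ and $K_\#(R)$ exist. Moreover: 1. If $0<R<R_*$, then the phase transition is discontinuous and $K_c(R)<K_\#(R)$. 2. If $R_*\le R\le\pi$, then the phase transition is continuous and $K_c(R)=K_\#(R)$. -/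

import Mathlib

open MeasureTheory Filter Topology
open scoped ENNReal

namespace MeanFieldCircle

/-- The uniform distribution `q_u` on the circle `𝕋 = ℝ/ℤ` (Lebesgue measure, of total mass `1`). -/
noncomputable def uniform : ProbabilityMeasure UnitAddCircle :=
  ⟨(volume : Measure UnitAddCircle), ⟨UnitAddCircle.measure_univ⟩⟩

/-- The free energy
`F_K(q) = ∫ log q dq - K ∬ W(θ - θ') dq(θ) dq(θ')`, with values in `(-∞, ∞]`.
The entropy `∫ log q dq` is the relative entropy of `q` with respect to Lebesgue measure; it is `∞`
if `q` is not absolutely continuous or if `log q` is not `q`-integrable.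
The potential `W` is continuous, so the double integral is that of a bounded function. -/
noncomputable def freeEnergy (W : C(UnitAddCircle, ℝ)) (K : ℝ)
    (q : ProbabilityMeasure UnitAddCircle) : EReal :=
  (InformationTheory.klDiv (q : Measure UnitAddCircle) volume : EReal)
    - ((K * ∫ x, ∫ y, W (x - y) ∂(q : Measure UnitAddCircle) ∂(q : Measure UnitAddCircle) : ℝ) :
        EReal)

/-- `q` is a global minimizer of `F_K` over all Borel probability measures on the circle. -/
def IsGlobalMinimizer (W : C(UnitAddCircle, ℝ)) (K : ℝ)
    (q : ProbabilityMeasure UnitAddCircle) : Prop :=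
  ∀ p : ProbabilityMeasure UnitAddCircle, freeEnergy W K q ≤ freeEnergy W K p

/-- `Kc` is the critical coupling of `W`: below it `q_u` is the unique minimizer, at it `q_u` is a
minimizer, above it there is a nonuniform minimizer. -/
structure IsCriticalCoupling (W : C(UnitAddCircle, ℝ)) (Kc : ℝ) : Prop where
  pos : 0 < Kc
  subcritical : ∀ K : ℝ, 0 ≤ K → K < Kc →
    ∀ q : ProbabilityMeasure UnitAddCircle, IsGlobalMinimizer W K q ↔ q = uniform
  critical : IsGlobalMinimizer W Kc uniform
  supercritical : ∀ K : ℝ, Kc < K →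
    ∃ q : ProbabilityMeasure UnitAddCircle, q ≠ uniform ∧ IsGlobalMinimizer W K q

/-- There is at most one critical coupling. -/
theorem IsCriticalCoupling.unique {W : C(UnitAddCircle, ℝ)} {a b : ℝ}
    (ha : IsCriticalCoupling W a) (hb : IsCriticalCoupling W b) : a = b := by
  have key : ∀ {a b : ℝ}, IsCriticalCoupling W a → IsCriticalCoupling W b → ¬ a < b := by
    intro a b ha hb h
    obtain ⟨q, hq, hm⟩ := ha.supercritical ((a + b) / 2) (by linarith)
    have h0 := ha.pos
    exact hq ((hb.subcritical _ (by linarith) (by linarith) q).1 hm)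
  exact le_antisymm (not_lt.1 (key hb ha)) (not_lt.1 (key ha hb))

/-- The `L¹` distance of (the density of) `q` to the uniform distribution. It is only used for
absolutely continuous `q`: every global minimizer of the free energy is one. -/
noncomputable def l1DistUniform (q : ProbabilityMeasure UnitAddCircle) : ℝ≥0∞ :=
  eLpNorm (fun x => ((q : Measure UnitAddCircle).rnDeriv volume x).toReal - 1) 1 volume

/-- The phase transition at `Kc` is continuous: the global minimizer at `Kc` is unique, and every
family of global minimizers `q_K`, `K > Kc`, converges to `q_u` in `L¹` as `K ↓ Kc`. A phase
transition is discontinuous if it is not continuous. -/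
def IsContinuousTransition (W : C(UnitAddCircle, ℝ)) (Kc : ℝ) : Prop :=
  (∃! q : ProbabilityMeasure UnitAddCircle, IsGlobalMinimizer W Kc q) ∧
    ∀ q : ℝ → ProbabilityMeasure UnitAddCircle,
      (∀ K : ℝ, Kc < K → IsGlobalMinimizer W K (q K)) →
        limsup (fun K => l1DistUniform (q K)) (𝓝[>] Kc) = 0

/-- The Fourier coefficient `Ŵ(k) = ∫ W(θ) exp(-2πikθ) dθ`, which is real as `W` is even. -/
noncomputable def fourierHat (W : C(UnitAddCircle, ℝ)) (k : ℕ) : ℝ :=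
  (fourierCoeff (fun x : UnitAddCircle => (W x : ℂ)) (k : ℤ)).re

/-- `Ks` is the linear stability threshold `K_# = 1 / (2 max Ŵ(k))`, the maximum being over all
`k ≥ 1` with `Ŵ(k) > 0` (and attained). -/
def IsLinearStabilityThreshold (W : C(UnitAddCircle, ℝ)) (Ks : ℝ) : Prop :=
  ∃ m : ℝ, IsGreatest (fourierHat W '' {k : ℕ | 1 ≤ k ∧ 0 < fourierHat W k}) m ∧
    Ks = 1 / (2 * m)

/-- The Hegselmann--Krause potential `W_R(θ) = (R - 2π|θ|)₊²`. On the circle, `‖θ‖` is `|θ|` for the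
representative `θ ∈ [-1/2, 1/2)`. -/
noncomputable def hkKernel (R : ℝ) : C(UnitAddCircle, ℝ) where
  toFun x := (max (R - 2 * Real.pi * ‖x‖) 0) ^ 2
  continuous_toFun := by fun_prop

/-- The potential in terms of the representative in `[-1/2, 1/2)`. -/
theorem hkKernel_coe (R θ : ℝ) (hθ : θ ∈ Set.Ico (-(1 / 2) : ℝ) (1 / 2)) :
    hkKernel R (θ : UnitAddCircle) = (max (R - 2 * Real.pi * |θ|) 0) ^ 2 := by
  have h : ‖(θ : UnitAddCircle)‖ = |θ| :=
    (AddCircle.norm_coe_eq_abs_iff (p := 1) (x := θ) one_ne_zero).2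
      (by rw [abs_one]; exact abs_le.2 ⟨by linarith [hθ.1], hθ.2.le⟩)
  simp only [hkKernel, ContinuousMap.coe_mk, h]

end MeanFieldCircle

/-!
The potential `W_R` has the cosine coefficients `w(k) = 2 (kR - sin kR) / (π k³) > 0`, so the free
energy relative to that of the uniform distribution is `E(q) - 2 K ∑ w(k) |q̂(k)|²`, with `E` the
entropy.

*Existence of minimizers and of the critical coupling.* Because `W_R` is positive definite, the
free energy has the same infimum as the dual functional
`2 K ∑ w(k) |a(k)|² - log ∫ exp (2 K ∑ 2 w(k) Re (conj a(k) e^{2πikx}))` of a sequence `a` of modes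
(`IsCosineSeries.dual_le_excess`, `IsCosineSeries.excess_gibbs_add`). The dual functional is
continuous on the compact polydisc of bounded sequences, and the Gibbs measure of a minimizer
of the dual functional minimizes the free energy. The critical coupling is the largest `K` at which
the uniform distribution is a minimizer.

*The continuous case.* The logarithmic Hardy–Littlewood–Sobolev inequality `∑ |q̂(k)|² / k ≤ E(q)`
(`sum_norm_modeOf_sq_div_le`) is the dual of the Lebedev–Milin inequality
`log ∫ exp (2 Re h) ≤ ∑ k |h(k)|²`, which follows by comparing the coefficients of `exp h` with
those of `exp (∑ k |h(k)|² z ^ k)`. At the linear stability threshold, `2 K w(k) = w(k) / w(1)`, so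
the uniform distribution is a minimizer as soon as `w(k) ≤ w(1) / k` for all `k`; it is the only one
if the inequality is strict for `k ≥ 3`, since equality fails for nonconstant densities with modes
of order at most two. Convergence as `K ↓ Kc` is then a compactness argument
(`IsCosineSeries.isContinuousTransition`).

*The discontinuous case.* If `w(2) > w(1) / 2`, the modes `a = (r, r²)` with small `r` make the dual
functional negative at the threshold, so that the critical coupling lies strictly below it. There
the uniform distribution is still locally stable, and the nonuniform minimizers for `K > Kc` stay
away from it (`IsCosineSeries.not_isContinuousTransition`).

The condition `w(2) ≤ w(1) / 2` reads `sin R (2 - cos R) ≤ R`, and it implies `R > 7 / 4`, for which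
`w(k) < w(1) / k` holds for all `k ≥ 3`.
-/

namespace MeanFieldCircle

/-! ### The Lebedev–Milin inequality for coefficients -/

/-- The coefficients `c n` of the formal power series `exp (∑ k ≥ 1, h k z ^ k)`, defined by the
recursion `(n + 1) c (n + 1) = ∑ i ≤ n, (i + 1) h (i + 1) c (n - i)` that expresses
`(exp h)' = h' exp h`. The value `h 0` is not used. -/
noncomputable def expCoeff {𝕜 : Type*} [Field 𝕜] (h : ℕ → 𝕜) : ℕ → 𝕜
  | 0 => 1
  | n + 1 => (∑ i : Fin (n + 1), ((i : ℕ) + 1 : 𝕜) * h (i + 1) * expCoeff h (n - i)) / (n + 1)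

lemma expCoeff_zero {𝕜 : Type*} [Field 𝕜] (h : ℕ → 𝕜) : expCoeff h 0 = 1 := by
  rw [expCoeff]

lemma succ_mul_expCoeff {𝕜 : Type*} [Field 𝕜] [CharZero 𝕜] (h : ℕ → 𝕜) (n : ℕ) :
    ((n : 𝕜) + 1) * expCoeff h (n + 1) =
      ∑ i ∈ Finset.range (n + 1), ((i : 𝕜) + 1) * h (i + 1) * expCoeff h (n - i) := by
  have hn : (n : 𝕜) + 1 ≠ 0 := Nat.cast_add_one_ne_zero n
  rw [expCoeff, mul_div_cancel₀ _ hn,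
    Finset.sum_range (fun i : ℕ => ((i : 𝕜) + 1) * h (i + 1) * expCoeff h (n - i))]

/-- The coefficientwise form of the Lebedev–Milin inequality: the squared coefficients of `exp h`
are dominated by the coefficients of `exp (∑ k, k |h k|² z ^ k)`. -/
lemma norm_expCoeff_sq_le (h : ℕ → ℂ) (n : ℕ) :
    ‖expCoeff h n‖ ^ 2 ≤ expCoeff (fun k : ℕ => (k : ℝ) * ‖h k‖ ^ 2) n := by
  induction n using Nat.strong_induction_on with
  | _ n ih =>
    rcases n with _ | n
    · simp [expCoeff_zero]
    · set b := expCoeff (fun k : ℕ => (k : ℝ) * ‖h k‖ ^ 2) with hb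
      have hn : (0 : ℝ) < (n : ℝ) + 1 := by positivity
      have h1 : ((n : ℝ) + 1) * ‖expCoeff h (n + 1)‖ =
          ‖∑ i ∈ Finset.range (n + 1), ((i : ℂ) + 1) * h (i + 1) * expCoeff h (n - i)‖ := by
        rw [← succ_mul_expCoeff h n, norm_mul]
        congr 1
        rw [← Nat.cast_succ, ← Nat.cast_succ, Complex.norm_natCast]
      have h2 : ((n : ℝ) + 1) * ‖expCoeff h (n + 1)‖ ≤
          ∑ i ∈ Finset.range (n + 1), ((i : ℝ) + 1) * ‖h (i + 1)‖ * ‖expCoeff h (n - i)‖ := by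
        rw [h1]
        refine (norm_sum_le _ _).trans (le_of_eq (Finset.sum_congr rfl fun i _ => ?_))
        rw [norm_mul, norm_mul, ← Nat.cast_succ, ← Nat.cast_succ, Complex.norm_natCast]
      have h3 : (((n : ℝ) + 1) * ‖expCoeff h (n + 1)‖) ^ 2 ≤ ((n : ℝ) + 1) *
          ∑ i ∈ Finset.range (n + 1),
            (((i : ℝ) + 1) * ‖h (i + 1)‖ * ‖expCoeff h (n - i)‖) ^ 2 := by
        refine (pow_le_pow_left₀ (by positivity) h2 2).trans ?_
        refine sq_sum_le_card_mul_sum_sq.trans (le_of_eq ?_)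
        simp
      have h4 : ∑ i ∈ Finset.range (n + 1),
            (((i : ℝ) + 1) * ‖h (i + 1)‖ * ‖expCoeff h (n - i)‖) ^ 2 ≤
          ((n : ℝ) + 1) * b (n + 1) := by
        rw [hb, succ_mul_expCoeff]
        refine Finset.sum_le_sum fun i _ => ?_
        have h5 := ih (n - i) (by omega)
        calc (((i : ℝ) + 1) * ‖h (i + 1)‖ * ‖expCoeff h (n - i)‖) ^ 2
            = ((i : ℝ) + 1) * (((i + 1 : ℕ) : ℝ) * ‖h (i + 1)‖ ^ 2) * ‖expCoeff h (n - i)‖ ^ 2 := by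
              push_cast; ring
          _ ≤ _ := by gcongr
      have h6 : (((n : ℝ) + 1) * ‖expCoeff h (n + 1)‖) ^ 2 ≤
          ((n : ℝ) + 1) * (((n : ℝ) + 1) * b (n + 1)) :=
        h3.trans (by gcongr)
      have h7 : ((n : ℝ) + 1) ^ 2 * ‖expCoeff h (n + 1)‖ ^ 2 ≤ ((n : ℝ) + 1) ^ 2 * b (n + 1) := by
        linarith [h6]
      exact le_of_mul_le_mul_left h7 (by positivity)

lemma expCoeff_ofReal (g : ℕ → ℝ) (n : ℕ) :
    expCoeff (fun k => (g k : ℂ)) n = (expCoeff g n : ℝ) := by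
  induction n using Nat.strong_induction_on with
  | _ n ih =>
    rcases n with _ | n
    · simp [expCoeff_zero]
    · rw [expCoeff, expCoeff]
      push_cast
      congr 1
      refine Finset.sum_congr rfl fun i _ => ?_
      rw [ih (n - i) (by omega)]

lemma expCoeff_one {𝕜 : Type*} [Field 𝕜] [CharZero 𝕜] (h : ℕ → 𝕜) : expCoeff h 1 = h 1 := by
  have := succ_mul_expCoeff h 0
  simpa [expCoeff_zero] using this

lemma expCoeff_two {𝕜 : Type*} [Field 𝕜] [CharZero 𝕜] (h : ℕ → 𝕜) :
    expCoeff h 2 = h 2 + h 1 ^ 2 / 2 := by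
  have := succ_mul_expCoeff h 1
  simp only [Finset.sum_range_succ, Finset.sum_range_zero] at this
  norm_num [expCoeff_zero, expCoeff_one] at this
  linear_combination this / 2

lemma expCoeff_three {𝕜 : Type*} [Field 𝕜] [CharZero 𝕜] (h : ℕ → 𝕜) :
    expCoeff h 3 = h 3 + h 1 * h 2 + h 1 ^ 3 / 6 := by
  have := succ_mul_expCoeff h 2
  simp only [Finset.sum_range_succ, Finset.sum_range_zero] at this
  norm_num [expCoeff_zero, expCoeff_one, expCoeff_two] at this
  linear_combination this / 3

/-- The strict case of the coefficient inequality for a polynomial `h 1 z + h 2 z ^ 2`. -/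
lemma exists_norm_expCoeff_sq_lt {h : ℕ → ℂ} (h3 : h 3 = 0) (h12 : h 1 ≠ 0 ∨ h 2 ≠ 0) :
    ∃ n, ‖expCoeff h n‖ ^ 2 < expCoeff (fun k : ℕ => (k : ℝ) * ‖h k‖ ^ 2) n := by
  by_cases h1 : h 1 = 0
  · refine ⟨2, ?_⟩
    have h2 : 0 < ‖h 2‖ := norm_pos_iff.2 (h12.resolve_left (not_not.2 h1))
    rw [expCoeff_two, expCoeff_two]
    simp only [h1]
    norm_num
    nlinarith [pow_pos h2 2]
  · refine ⟨3, ?_⟩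
    have hpos : 0 < ‖h 1‖ := norm_pos_iff.2 h1
    rw [expCoeff_three, expCoeff_three, h3]
    have e : (0 : ℂ) + h 1 * h 2 + h 1 ^ 3 / 6 = h 1 * (h 2 + h 1 ^ 2 / 6) := by ring
    rw [e, norm_mul, mul_pow]
    have hle : ‖h 2 + h 1 ^ 2 / 6‖ ≤ ‖h 2‖ + ‖h 1‖ ^ 2 / 6 := by
      refine (norm_add_le _ _).trans (le_of_eq ?_)
      simp
    have hsq : ‖h 2 + h 1 ^ 2 / 6‖ ^ 2 ≤ (‖h 2‖ + ‖h 1‖ ^ 2 / 6) ^ 2 :=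
      pow_le_pow_left₀ (norm_nonneg _) hle 2
    have hlt : (‖h 2‖ + ‖h 1‖ ^ 2 / 6) ^ 2 < 2 * ‖h 2‖ ^ 2 + ‖h 1‖ ^ 4 / 6 := by
      have : 0 < ‖h 1‖ ^ 4 := by positivity
      nlinarith [sq_nonneg (‖h 2‖ - ‖h 1‖ ^ 2 / 6)]
    have := mul_lt_mul_of_pos_left (hsq.trans_lt hlt) (by positivity : 0 < ‖h 1‖ ^ 2)
    norm_num
    nlinarith [this]

lemma iteratedDeriv_exp_eval (P : Polynomial ℂ) (n : ℕ) :
    iteratedDeriv n (fun z => Complex.exp (P.eval z)) 0 =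
      Complex.exp (P.coeff 0) * (n.factorial * expCoeff P.coeff n) := by
  induction n using Nat.strong_induction_on with
  | _ n ih =>
    rcases n with _ | n
    · simp [expCoeff_zero, Polynomial.coeff_zero_eq_eval_zero]
    · have hd : deriv (fun z => Complex.exp (P.eval z)) =
          fun z => P.derivative.eval z * Complex.exp (P.eval z) := by
        funext z
        rw [((P.hasDerivAt z).cexp).deriv, mul_comm]
      have hD : ∀ (i : ℕ) (Q : Polynomial ℂ), iteratedDeriv i (fun z => Q.eval z) 0 =
          i.factorial * Q.coeff i := by
        intro i
        induction i with
        | zero => intro Q; simp [Polynomial.coeff_zero_eq_eval_zero]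
        | succ i ihi =>
          intro Q
          have : deriv (fun z => Q.eval z) = fun z => Q.derivative.eval z := by
            funext z; exact Q.deriv
          rw [iteratedDeriv_succ', this, ihi, Polynomial.coeff_derivative, Nat.factorial_succ]
          push_cast; ring
      have hP : ContDiff ℂ n (fun z => P.derivative.eval z) :=
        P.derivative.differentiable.contDiff
      have hE : ContDiff ℂ n (fun z => Complex.exp (P.eval z)) :=
        P.differentiable.contDiff.cexp
      rw [iteratedDeriv_succ', hd, iteratedDeriv_fun_mul hP.contDiffAt hE.contDiffAt]
      have key : ((n + 1).factorial : ℂ) * expCoeff P.coeff (n + 1) =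
          n.factorial * (((n : ℂ) + 1) * expCoeff P.coeff (n + 1)) := by
        rw [Nat.factorial_succ]; push_cast; ring
      rw [key, succ_mul_expCoeff, Finset.mul_sum, Finset.mul_sum]
      refine Finset.sum_congr rfl fun i hi => ?_
      have hin : i ≤ n := Nat.lt_succ_iff.1 (Finset.mem_range.1 hi)
      rw [hD, ih (n - i) (by omega), Polynomial.coeff_derivative,
        ← Nat.choose_mul_factorial_mul_factorial hin]
      push_cast; ring

lemma hasSum_exp_eval (P : Polynomial ℂ) (h0 : P.coeff 0 = 0) (z : ℂ) :
    HasSum (fun n => expCoeff P.coeff n * z ^ n) (Complex.exp (P.eval z)) := by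
  have hf : Differentiable ℂ (fun z => Complex.exp (P.eval z)) :=
    P.differentiable.cexp
  have := Complex.hasSum_taylorSeries_of_entire hf 0 z
  convert! this using 2 with n
  have hn : (n.factorial : ℂ) ≠ 0 := Nat.cast_ne_zero.2 n.factorial_ne_zero
  rw [iteratedDeriv_exp_eval, h0]
  simp only [sub_zero, smul_eq_mul, Complex.exp_zero, one_mul]
  field_simp

/-! ### Fourier series on the circle and the Lebedev–Milin inequality -/

lemma volume_eq_haarAddCircle :
    (volume : Measure UnitAddCircle) = AddCircle.haarAddCircle := by
  rw [AddCircle.volume_eq_smul_haarAddCircle]; simp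

instance : IsProbabilityMeasure (volume : Measure UnitAddCircle) := ⟨UnitAddCircle.measure_univ⟩

lemma norm_fourier_apply (n : ℤ) (x : UnitAddCircle) : ‖fourier n x‖ = 1 := by
  rw [fourier_apply]; exact Circle.norm_coe _

/-- Termwise integration of a series of continuous functions dominated by a convergent series. -/
lemma hasSum_integral_of_bound {X E : Type*} [TopologicalSpace X] [CompactSpace X]
    [MeasurableSpace X] [OpensMeasurableSpace X] [NormedAddCommGroup E] [NormedSpace ℝ E]
    [SecondCountableTopologyEither X E]
    {μ : Measure X} [IsFiniteMeasure μ] {φ : ℕ → X → E} {u : ℕ → ℝ} {F : X → E}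
    (hcont : ∀ n, Continuous (φ n)) (hb : ∀ n x, ‖φ n x‖ ≤ u n) (hu : Summable u)
    (hF : ∀ x, HasSum (fun n => φ n x) (F x)) :
    HasSum (fun n => ∫ x, φ n x ∂μ) (∫ x, F x ∂μ) := by
  have hint : ∀ n, Integrable (φ n) μ := fun n =>
    Integrable.of_bound (hcont n).aestronglyMeasurable (u n) (ae_of_all _ (hb n))
  have hs : Summable fun n => ∫ x, ‖φ n x‖ ∂μ := by
    refine Summable.of_nonneg_of_le (fun n => integral_nonneg fun x => norm_nonneg _)
      (fun n => ?_) (hu.mul_left (μ.real Set.univ))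
    refine (integral_mono (hint n).norm (integrable_const (u n)) (hb n)).trans (le_of_eq ?_)
    simp
  have := hasSum_integral_of_summable_integral_norm hint hs
  rwa [integral_congr_ae (ae_of_all _ fun x => (hF x).tsum_eq)] at this

lemma integral_fourier (n : ℤ) :
    ∫ x : UnitAddCircle, fourier n x = if n = 0 then 1 else 0 := by
  have h := congrFun (fourierCoeff_fourier (T := 1) n) 0
  rw [fourierCoeff, ← volume_eq_haarAddCircle] at h
  simp only [neg_zero, fourier_zero, one_smul] at h
  rw [h, Pi.single_apply]
  simp [eq_comm]

lemma integral_fourier_mul_conj (n m : ℤ) :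
    ∫ x : UnitAddCircle, fourier n x * (starRingEnd ℂ) (fourier m x) = if n = m then 1 else 0 := by
  have : ∀ x : UnitAddCircle, fourier n x * (starRingEnd ℂ) (fourier m x) = fourier (n - m) x := by
    intro x
    rw [← fourier_neg, ← fourier_add, sub_eq_add_neg]
  simp only [this, integral_fourier, sub_eq_zero]

/-- Parseval's identity for an absolutely convergent series of nonnegative frequencies. -/
lemma hasSum_norm_sq {c : ℕ → ℂ} {F : UnitAddCircle → ℂ} (hc : Summable fun n => ‖c n‖)
    (hF : ∀ x, HasSum (fun n => c n * fourier (n : ℤ) x) (F x)) (hFc : Continuous F) :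
    HasSum (fun n => ‖c n‖ ^ 2) (∫ x, ‖F x‖ ^ 2) := by
  obtain ⟨B, hB⟩ : ∃ B, ∀ x, ‖F x‖ ≤ B := by
    obtain ⟨B, hB⟩ := isCompact_univ.exists_bound_of_continuousOn hFc.continuousOn
    exact ⟨B, fun x => hB x trivial⟩
  have h1 : ∀ m : ℕ, ∫ x, F x * (starRingEnd ℂ) (fourier (m : ℤ) x) = c m := by
    intro m
    have h := hasSum_integral_of_bound (μ := (volume : Measure UnitAddCircle))
      (φ := fun n x => c n * fourier (n : ℤ) x * (starRingEnd ℂ) (fourier (m : ℤ) x))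
      (u := fun n => ‖c n‖) (by intro n; fun_prop)
      (by intro n x; simp only [norm_mul, norm_fourier_apply, RCLike.norm_conj, mul_one, le_refl]) hc (fun x => (hF x).mul_right _)
    simp only [mul_assoc, integral_const_mul, integral_fourier_mul_conj, Nat.cast_inj] at h
    refine h.unique ?_
    convert! hasSum_ite_eq m (c m) using 2 with n
    split_ifs with hnm <;> simp [hnm]
  have h2 := hasSum_integral_of_bound (μ := (volume : Measure UnitAddCircle))
      (φ := fun n x => c n * fourier (n : ℤ) x * (starRingEnd ℂ) (F x))
      (u := fun n => ‖c n‖ * B) (by intro n; fun_prop)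
      (by
        intro n x
        simp only [norm_mul, norm_fourier_apply, RCLike.norm_conj, mul_one]
        gcongr; exact hB x) (hc.mul_right B) (fun x => (hF x).mul_right _)
  have h3 : ∀ n : ℕ, ∫ x, c n * fourier (n : ℤ) x * (starRingEnd ℂ) (F x) =
      ((‖c n‖ ^ 2 : ℝ) : ℂ) := by
    intro n
    simp only [mul_assoc, integral_const_mul]
    have : ∀ x, fourier (n : ℤ) x * (starRingEnd ℂ) (F x) =
        (starRingEnd ℂ) (F x * (starRingEnd ℂ) (fourier (n : ℤ) x)) := by
      intro x; simp [mul_comm]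
    simp only [this]
    rw [integral_conj, h1, Complex.mul_conj, Complex.normSq_eq_norm_sq]
  simp only [h3, Complex.mul_conj, Complex.normSq_eq_norm_sq] at h2
  rw [integral_complex_ofReal] at h2
  exact_mod_cast h2

lemma fourier_natCast (n : ℕ) (x : UnitAddCircle) : fourier (n : ℤ) x = fourier 1 x ^ n := by
  simp [fourier_apply, AddCircle.toCircle_nsmul]

/-- `∫ exp (2 Re h) = ∑ |c n|²` where `h` is a polynomial in `e^{2πix}` without constant term and
`c n` are the coefficients of `exp h`. -/
lemma hasSum_norm_expCoeff_sq (P : Polynomial ℂ) (h0 : P.coeff 0 = 0) :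
    HasSum (fun n => ‖expCoeff P.coeff n‖ ^ 2)
      (∫ x : UnitAddCircle, Real.exp (2 * (P.eval (fourier 1 x)).re)) := by
  have hs : ∀ x : UnitAddCircle, HasSum (fun n : ℕ => expCoeff P.coeff n * fourier (n : ℤ) x)
      (Complex.exp (P.eval (fourier 1 x))) := by
    intro x
    simp only [fourier_natCast]
    exact hasSum_exp_eval P h0 _
  have hc : Summable fun n => ‖expCoeff P.coeff n‖ := by
    have := (hasSum_exp_eval P h0 1).summable.norm
    simpa using this
  have := hasSum_norm_sq hc hs (by fun_prop)
  convert! this using 3 with x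
  rw [Complex.norm_exp, ← Real.exp_nat_mul]
  norm_num

lemma hasSum_expCoeff_weighted (P : Polynomial ℂ) {N : ℕ} (hN : P.natDegree < N) :
    HasSum (expCoeff (fun k : ℕ => (k : ℝ) * ‖P.coeff k‖ ^ 2))
      (Real.exp (∑ k ∈ Finset.range N, (k : ℝ) * ‖P.coeff k‖ ^ 2)) := by
  set g : ℕ → ℝ := fun k => (k : ℝ) * ‖P.coeff k‖ ^ 2 with hg
  let Q : Polynomial ℂ := ∑ k ∈ Finset.range N, Polynomial.monomial k (g k : ℂ)
  have hQ : Q.coeff = fun k => (g k : ℂ) := by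
    funext k
    simp only [Q, Polynomial.finsetSum_coeff, Polynomial.coeff_monomial]
    rw [Finset.sum_ite_eq']
    split_ifs with hk
    · rfl
    · rw [hg]
      simp only
      rw [Polynomial.coeff_eq_zero_of_natDegree_lt (hN.trans_le (by simpa using hk))]
      simp
  have h := hasSum_exp_eval Q (by rw [hQ]; simp [hg]) 1
  have he : Q.eval 1 = ((∑ k ∈ Finset.range N, g k : ℝ) : ℂ) := by
    simp [Q, Polynomial.eval_finsetSum]
  rw [he, hQ] at h
  simp only [expCoeff_ofReal, one_pow, mul_one] at h
  exact_mod_cast h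

/-- The Lebedev–Milin inequality, for polynomials. -/
lemma integral_exp_le (P : Polynomial ℂ) (h0 : P.coeff 0 = 0) {N : ℕ} (hN : P.natDegree < N) :
    ∫ x : UnitAddCircle, Real.exp (2 * (P.eval (fourier 1 x)).re) ≤
      Real.exp (∑ k ∈ Finset.range N, (k : ℝ) * ‖P.coeff k‖ ^ 2) :=
  hasSum_le (norm_expCoeff_sq_le P.coeff) (hasSum_norm_expCoeff_sq P h0)
    (hasSum_expCoeff_weighted P hN)

lemma integral_exp_lt (P : Polynomial ℂ) (h0 : P.coeff 0 = 0) (h3 : P.coeff 3 = 0)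
    (h12 : P.coeff 1 ≠ 0 ∨ P.coeff 2 ≠ 0) {N : ℕ} (hN : P.natDegree < N) :
    ∫ x : UnitAddCircle, Real.exp (2 * (P.eval (fourier 1 x)).re) <
      Real.exp (∑ k ∈ Finset.range N, (k : ℝ) * ‖P.coeff k‖ ^ 2) := by
  obtain ⟨n, hn⟩ := exists_norm_expCoeff_sq_lt h3 h12
  exact hasSum_lt (norm_expCoeff_sq_le P.coeff) hn (hasSum_norm_expCoeff_sq P h0)
    (hasSum_expCoeff_weighted P hN)

lemma le_integral_exp (P : Polynomial ℂ) (h0 : P.coeff 0 = 0) :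
    1 + ‖P.coeff 1‖ ^ 2 + ‖P.coeff 2 + P.coeff 1 ^ 2 / 2‖ ^ 2 ≤
      ∫ x : UnitAddCircle, Real.exp (2 * (P.eval (fourier 1 x)).re) := by
  have := sum_le_hasSum (Finset.range 3) (fun n _ => by positivity) (hasSum_norm_expCoeff_sq P h0)
  simpa [Finset.sum_range_succ, expCoeff_zero, expCoeff_one, expCoeff_two] using this

lemma coeff_sum_monomial (h : ℕ → ℂ) (N k : ℕ) :
    (∑ j ∈ Finset.range N, Polynomial.monomial j (h j)).coeff k = if k < N then h k else 0 := by
  simp only [Polynomial.finsetSum_coeff, Polynomial.coeff_monomial, Finset.sum_ite_eq',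
    Finset.mem_range]

lemma eval_sum_monomial (h : ℕ → ℂ) (N : ℕ) (x : UnitAddCircle) :
    (∑ j ∈ Finset.range N, Polynomial.monomial j (h j)).eval (fourier 1 x) =
      ∑ j ∈ Finset.range N, h j * fourier (j : ℤ) x := by
  simp only [Polynomial.eval_finsetSum, Polynomial.eval_monomial, fourier_natCast]

lemma natDegree_sum_monomial_lt (h : ℕ → ℂ) {N : ℕ} (hN : 0 < N) :
    (∑ j ∈ Finset.range N, Polynomial.monomial j (h j)).natDegree < N := by
  refine lt_of_le_of_lt (b := N - 1) (Polynomial.natDegree_le_iff_coeff_eq_zero.2 fun k hk => ?_)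
    (Nat.sub_lt hN one_pos)
  rw [coeff_sum_monomial, if_neg (by omega)]

/-- The Lebedev–Milin inequality, for real trigonometric polynomials of mean zero. -/
lemma integral_exp_sum_le (h : ℕ → ℂ) (h0 : h 0 = 0) {N : ℕ} (hN : 0 < N) :
    ∫ x : UnitAddCircle, Real.exp (2 * (∑ k ∈ Finset.range N, h k * fourier (k : ℤ) x).re) ≤
      Real.exp (∑ k ∈ Finset.range N, (k : ℝ) * ‖h k‖ ^ 2) := by
  have := integral_exp_le (∑ j ∈ Finset.range N, Polynomial.monomial j (h j))
    (by rw [coeff_sum_monomial]; simp [h0]) (natDegree_sum_monomial_lt h hN)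
  simp only [eval_sum_monomial, coeff_sum_monomial] at this
  refine this.trans_eq (congrArg _ (Finset.sum_congr rfl fun k hk => ?_))
  rw [if_pos (Finset.mem_range.1 hk)]

/-- Equality in the Lebedev–Milin inequality is excluded for trigonometric polynomials of degree
at most two, unless they vanish. -/
lemma integral_exp_sum_lt (h : ℕ → ℂ) (h0 : h 0 = 0) (h12 : h 1 ≠ 0 ∨ h 2 ≠ 0) :
    ∫ x : UnitAddCircle, Real.exp (2 * (∑ k ∈ Finset.range 3, h k * fourier (k : ℤ) x).re) <
      Real.exp (∑ k ∈ Finset.range 3, (k : ℝ) * ‖h k‖ ^ 2) := by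
  have := integral_exp_lt (∑ j ∈ Finset.range 3, Polynomial.monomial j (h j))
    (by rw [coeff_sum_monomial]; simp [h0]) (by rw [coeff_sum_monomial]; simp)
    (by rw [coeff_sum_monomial, coeff_sum_monomial]; simpa using h12) (natDegree_sum_monomial_lt h three_pos)
  simp only [eval_sum_monomial, coeff_sum_monomial] at this
  refine this.trans_eq (congrArg _ (Finset.sum_congr rfl fun k hk => ?_))
  rw [if_pos (Finset.mem_range.1 hk)]

lemma le_integral_exp_sum (h : ℕ → ℂ) (h0 : h 0 = 0) :
    1 + ‖h 1‖ ^ 2 + ‖h 2 + h 1 ^ 2 / 2‖ ^ 2 ≤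
      ∫ x : UnitAddCircle,
        Real.exp (2 * (∑ k ∈ Finset.range 3, h k * fourier (k : ℤ) x).re) := by
  have := le_integral_exp (∑ j ∈ Finset.range 3, Polynomial.monomial j (h j))
    (by rw [coeff_sum_monomial]; simp [h0])
  simpa only [eval_sum_monomial, coeff_sum_monomial, Nat.one_lt_ofNat, if_true,
    Nat.lt_add_one] using this

/-! ### Entropy, Gibbs measures and the logarithmic Hardy–Littlewood–Sobolev inequality -/

open InformationTheory

/-- The `k`-th Fourier coefficient `∫ e^{2πikx} dq(x)` of a probability measure. -/
noncomputable def modeOf (q : ProbabilityMeasure UnitAddCircle) (k : ℕ) : ℂ :=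
  ∫ x, fourier (k : ℤ) x ∂(q : Measure UnitAddCircle)

/-- The relative entropy of `q` with respect to Lebesgue measure. -/
noncomputable def entropy (q : ProbabilityMeasure UnitAddCircle) : ℝ≥0∞ :=
  klDiv (q : Measure UnitAddCircle) volume

lemma entropy_uniform : entropy uniform = 0 := klDiv_self _

lemma entropy_eq_zero_iff {q : ProbabilityMeasure UnitAddCircle} :
    entropy q = 0 ↔ q = uniform := by
  rw [entropy, klDiv_eq_zero_iff]
  exact ⟨fun h => Subtype.ext h, fun h => congrArg Subtype.val h⟩

lemma norm_modeOf_le (q : ProbabilityMeasure UnitAddCircle) (k : ℕ) : ‖modeOf q k‖ ≤ 1 := by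
  refine (norm_integral_le_of_norm_le_const (C := 1) (ae_of_all _ fun x => ?_)).trans_eq ?_
  · exact (norm_fourier_apply _ x).le
  · simp

lemma modeOf_uniform {k : ℕ} (hk : k ≠ 0) : modeOf uniform k = 0 := by
  have := integral_fourier (k : ℤ)
  rw [if_neg (by exact_mod_cast hk)] at this
  exact this

lemma integrable_of_continuous {E : Type*} [NormedAddCommGroup E] [SecondCountableTopology E]
    (μ : Measure UnitAddCircle) [IsFiniteMeasure μ] {f : UnitAddCircle → E} (hf : Continuous f) :
    Integrable f μ := by
  obtain ⟨B, hB⟩ := isCompact_univ.exists_bound_of_continuousOn hf.continuousOn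
  exact Integrable.of_bound hf.aestronglyMeasurable B (ae_of_all _ fun x => hB x trivial)

/-- The Gibbs variational inequality. -/
lemma integral_sub_log_le_entropy {q : ProbabilityMeasure UnitAddCircle} (hq : entropy q ≠ ∞)
    {f : UnitAddCircle → ℝ} (hf : Continuous f) :
    ∫ x, f x ∂(q : Measure UnitAddCircle) - Real.log (∫ x, Real.exp (f x)) ≤
      (entropy q).toReal := by
  obtain ⟨hac, hint⟩ := klDiv_ne_top_iff.1 hq
  have he : Integrable (fun x => Real.exp (f x)) (volume : Measure UnitAddCircle) :=
    integrable_of_continuous _ (by fun_prop)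
  have hfq : Integrable f (q : Measure UnitAddCircle) := integrable_of_continuous _ hf
  have : IsProbabilityMeasure ((volume : Measure UnitAddCircle).tilted f) :=
    isProbabilityMeasure_tilted he
  have h1 := integral_llr_add_sub_measure_univ_nonneg
    (hac.trans (absolutelyContinuous_tilted he))
    (integrable_llr_tilted_right hac hfq hint he)
  rw [integral_llr_tilted_right hac hfq he hint] at h1
  rw [entropy, toReal_klDiv hac hint]
  simp only [probReal_univ] at h1 ⊢
  linarith

/-- The Gibbs measure `e^f / ∫ e^f`. -/
noncomputable def gibbs (f : C(UnitAddCircle, ℝ)) : ProbabilityMeasure UnitAddCircle :=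
  ⟨(volume : Measure UnitAddCircle).tilted f,
    isProbabilityMeasure_tilted (integrable_of_continuous _ (by fun_prop))⟩

lemma entropy_gibbs (f : C(UnitAddCircle, ℝ)) :
    entropy (gibbs f) ≠ ∞ ∧ (entropy (gibbs f)).toReal =
      ∫ x, f x ∂(gibbs f : Measure UnitAddCircle) - Real.log (∫ x, Real.exp (f x)) := by
  have he : Integrable (fun x => Real.exp (f x)) (volume : Measure UnitAddCircle) :=
    integrable_of_continuous _ (by fun_prop)
  have hg : (gibbs f : Measure UnitAddCircle) = (volume : Measure UnitAddCircle).tilted f := rfl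
  have hac : (gibbs f : Measure UnitAddCircle) ≪ volume := tilted_absolutelyContinuous _ _
  have hl : llr (gibbs f : Measure UnitAddCircle) volume =ᵐ[(gibbs f : Measure UnitAddCircle)]
      fun x => f x - Real.log (∫ x, Real.exp (f x)) :=
    hac.ae_le (log_rnDeriv_tilted_left_self he)
  have hfi : Integrable f (gibbs f : Measure UnitAddCircle) :=
    integrable_of_continuous _ f.continuous
  have hint : Integrable (llr (gibbs f : Measure UnitAddCircle) volume)
      (gibbs f : Measure UnitAddCircle) :=
    (integrable_congr hl).2 (hfi.sub (integrable_const _))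
  refine ⟨klDiv_ne_top hac hint, ?_⟩
  rw [entropy, toReal_klDiv hac hint, integral_congr_ae hl, integral_sub hfi (integrable_const _)]
  simp

lemma integral_re_sum (q : ProbabilityMeasure UnitAddCircle) (h : ℕ → ℂ) (N : ℕ) :
    ∫ x, 2 * (∑ k ∈ Finset.range N, h k * fourier (k : ℤ) x).re ∂(q : Measure UnitAddCircle) =
      ∑ k ∈ Finset.range N, 2 * (h k * modeOf q k).re := by
  have hi : ∀ k : ℕ, Integrable (fun x => h k * fourier (k : ℤ) x) (q : Measure UnitAddCircle) :=
    fun k => integrable_of_continuous _ (by fun_prop)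
  rw [integral_const_mul]
  have h1 := integral_re (integrable_finsetSum (Finset.range N) fun k _ => hi k)
  have h2 : ∫ x, ∑ k ∈ Finset.range N, h k * fourier (k : ℤ) x ∂(q : Measure UnitAddCircle) =
      ∑ k ∈ Finset.range N, h k * modeOf q k := by
    rw [integral_finsetSum _ fun k _ => hi k]
    simp only [integral_const_mul, modeOf]
  rw [h2] at h1
  rw [← Finset.mul_sum, ← Complex.re_sum]
  exact congrArg _ h1

lemma inv_mul_conj_mul (a : ℂ) (k : ℕ) :
    2 * ((k : ℂ)⁻¹ * (starRingEnd ℂ) a * a).re - (k : ℝ) * ‖(k : ℂ)⁻¹ * (starRingEnd ℂ) a‖ ^ 2 =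
      ‖a‖ ^ 2 / k := by
  rcases eq_or_ne k 0 with rfl | hk
  · simp
  · have hk' : (k : ℝ) ≠ 0 := Nat.cast_ne_zero.2 hk
    rw [mul_assoc, ← Complex.normSq_eq_conj_mul_self, Complex.normSq_eq_norm_sq, norm_mul,
      norm_inv, RCLike.norm_conj, Complex.norm_natCast]
    have : ((k : ℂ)⁻¹ * ((‖a‖ ^ 2 : ℝ) : ℂ)).re = (k : ℝ)⁻¹ * ‖a‖ ^ 2 := by
      rw [← Complex.ofReal_natCast, ← Complex.ofReal_inv, ← Complex.ofReal_mul, Complex.ofReal_re]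
    rw [this]
    field_simp
    ring

/-- The logarithmic Hardy–Littlewood–Sobolev inequality on the circle,
`∑ |q̂(k)|² / k ≤ ∫ log q dq`, which is dual to the Lebedev–Milin inequality. -/
lemma sum_norm_modeOf_sq_div_le {q : ProbabilityMeasure UnitAddCircle} (hq : entropy q ≠ ∞)
    {N : ℕ} (hN : 0 < N) :
    ∑ k ∈ Finset.range N, ‖modeOf q k‖ ^ 2 / k ≤ (entropy q).toReal := by
  set h : ℕ → ℂ := fun k => (k : ℂ)⁻¹ * (starRingEnd ℂ) (modeOf q k) with hh
  have h1 := integral_sub_log_le_entropy hq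
    (f := fun x => 2 * (∑ k ∈ Finset.range N, h k * fourier (k : ℤ) x).re) (by fun_prop)
  have h2 := integral_exp_sum_le h (by simp [hh]) hN
  have hpos : 0 < ∫ x : UnitAddCircle,
      Real.exp (2 * (∑ k ∈ Finset.range N, h k * fourier (k : ℤ) x).re) :=
    integral_exp_pos (integrable_of_continuous _ (by fun_prop))
  have h3 := (Real.log_le_iff_le_exp hpos).2 h2
  rw [integral_re_sum] at h1
  calc ∑ k ∈ Finset.range N, ‖modeOf q k‖ ^ 2 / k
      = ∑ k ∈ Finset.range N, 2 * (h k * modeOf q k).re -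
          ∑ k ∈ Finset.range N, (k : ℝ) * ‖h k‖ ^ 2 := by
        rw [← Finset.sum_sub_distrib]
        exact Finset.sum_congr rfl fun k _ => (inv_mul_conj_mul _ _).symm
    _ ≤ _ := by linarith

/-- Strictness in the logarithmic Hardy–Littlewood–Sobolev inequality, seen on the first two
modes. -/
lemma norm_modeOf_sq_add_lt {q : ProbabilityMeasure UnitAddCircle} (hq : entropy q ≠ ∞)
    (h12 : modeOf q 1 ≠ 0 ∨ modeOf q 2 ≠ 0) :
    ‖modeOf q 1‖ ^ 2 + ‖modeOf q 2‖ ^ 2 / 2 < (entropy q).toReal := by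
  set h : ℕ → ℂ := fun k => (k : ℂ)⁻¹ * (starRingEnd ℂ) (modeOf q k) with hh
  have h1 := integral_sub_log_le_entropy hq
    (f := fun x => 2 * (∑ k ∈ Finset.range 3, h k * fourier (k : ℤ) x).re) (by fun_prop)
  have h2 := integral_exp_sum_lt h (by simp [hh]) (by simpa [hh] using h12)
  have hpos : 0 < ∫ x : UnitAddCircle,
      Real.exp (2 * (∑ k ∈ Finset.range 3, h k * fourier (k : ℤ) x).re) :=
    integral_exp_pos (integrable_of_continuous _ (by fun_prop))
  have h3 := (Real.log_lt_iff_lt_exp hpos).2 h2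
  rw [integral_re_sum] at h1
  calc ‖modeOf q 1‖ ^ 2 + ‖modeOf q 2‖ ^ 2 / 2
      = ∑ k ∈ Finset.range 3, ‖modeOf q k‖ ^ 2 / k := by simp [Finset.sum_range_succ]
    _ = ∑ k ∈ Finset.range 3, 2 * (h k * modeOf q k).re -
          ∑ k ∈ Finset.range 3, (k : ℝ) * ‖h k‖ ^ 2 := by
        rw [← Finset.sum_sub_distrib]
        exact Finset.sum_congr rfl fun k _ => (inv_mul_conj_mul _ _).symm
    _ < _ := by linarith

lemma mul_abs_sub_one_le_klFun {x t : ℝ} (hx : 0 ≤ x) (ht : 0 ≤ t) (ht1 : t ≤ 1) :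
    t * |x - 1| ≤ klFun x + t ^ 2 := by
  -- Fenchel's inequality `s x - exp s ≤ x log x - x`, used with `s = ± t`
  have key : ∀ s : ℝ, |s| ≤ 1 → s * (x - 1) ≤ klFun x + s ^ 2 := by
    intro s hs
    have h1 := (abs_le.1 (Real.abs_exp_sub_one_sub_id_le hs)).2
    have h2 : s * x - Real.exp s ≤ x * Real.log x - x := by
      rcases hx.eq_or_lt with rfl | hx
      · simp [Real.exp_nonneg]
      · have h3 := Real.add_one_le_exp (s - Real.log x)
        rw [Real.exp_sub, Real.exp_log hx, le_div_iff₀ hx] at h3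
        linarith
    rw [klFun_apply]
    linarith
  have h1 := key t (by rwa [abs_of_nonneg ht])
  have h2 := key (-t) (by rwa [abs_neg, abs_of_nonneg ht])
  rcases abs_cases (x - 1) with ⟨h, _⟩ | ⟨h, _⟩ <;> rw [h] <;> nlinarith

/-- A weak form of Pinsker's inequality. -/
lemma l1DistUniform_le {q : ProbabilityMeasure UnitAddCircle} (hq : entropy q ≠ ∞) {t : ℝ}
    (ht : 0 < t) (ht1 : t ≤ 1) :
    l1DistUniform q ≤ ENNReal.ofReal ((entropy q).toReal / t + t) := by
  obtain ⟨hac, hint⟩ := klDiv_ne_top_iff.1 hq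
  have hi := (integrable_klFun_rnDeriv_iff hac).2 hint
  rw [l1DistUniform, eLpNorm_one_eq_lintegral_enorm]
  have hb : Integrable (fun x => klFun ((q : Measure UnitAddCircle).rnDeriv volume x).toReal / t + t)
      volume := (hi.div_const t).add (integrable_const t)
  calc ∫⁻ x, ‖((q : Measure UnitAddCircle).rnDeriv volume x).toReal - 1‖ₑ
      ≤ ∫⁻ x, ENNReal.ofReal
          (klFun ((q : Measure UnitAddCircle).rnDeriv volume x).toReal / t + t) := by
        refine lintegral_mono fun x => ?_
        rw [Real.enorm_eq_ofReal_abs]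
        refine ENNReal.ofReal_le_ofReal ?_
        have := mul_abs_sub_one_le_klFun
          (x := ((q : Measure UnitAddCircle).rnDeriv volume x).toReal)
          ENNReal.toReal_nonneg ht.le ht1
        rw [← sub_nonneg] at this ⊢
        have e := div_nonneg this ht.le
        convert! e using 1
        field_simp
    _ = ENNReal.ofReal (∫ x,
          (klFun ((q : Measure UnitAddCircle).rnDeriv volume x).toReal / t + t)) := by
        rw [ofReal_integral_eq_lintegral_ofReal hb]
        exact ae_of_all _ fun x => add_nonneg
          (div_nonneg (klFun_nonneg ENNReal.toReal_nonneg) ht.le) ht.le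
    _ = _ := by
        rw [integral_add (hi.div_const t) (integrable_const t), integral_div,
          entropy, toReal_klDiv_eq_integral_klFun hac]
        simp

lemma enorm_modeOf_le {q : ProbabilityMeasure UnitAddCircle} (hq : entropy q ≠ ∞) {k : ℕ}
    (hk : k ≠ 0) : ‖modeOf q k‖ₑ ≤ l1DistUniform q := by
  obtain ⟨hac, -⟩ := klDiv_ne_top_iff.1 hq
  have hρ : Integrable (fun x => ((q : Measure UnitAddCircle).rnDeriv volume x).toReal)
      (volume : Measure UnitAddCircle) := Measure.integrable_toReal_rnDeriv
  have h1 : modeOf q k = ∫ x : UnitAddCircle,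
      (((q : Measure UnitAddCircle).rnDeriv volume x).toReal - 1) • fourier (k : ℤ) x := by
    have hk0 : ∫ x : UnitAddCircle, fourier (k : ℤ) x = 0 := by
      rw [integral_fourier, if_neg (by exact_mod_cast hk)]
    have hi : Integrable (fun x => ((q : Measure UnitAddCircle).rnDeriv volume x).toReal •
        fourier (k : ℤ) x) (volume : Measure UnitAddCircle) := by
      refine hρ.mono (hρ.1.smul (by fun_prop)) (ae_of_all _ fun x => ?_)
      rw [norm_smul, norm_fourier_apply, mul_one]
    simp only [sub_smul, one_smul]
    rw [integral_sub hi (integrable_of_continuous _ (by fun_prop)), hk0, sub_zero,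
      integral_rnDeriv_smul hac, modeOf]
  rw [h1, l1DistUniform, eLpNorm_one_eq_lintegral_enorm]
  refine (enorm_integral_le_lintegral_enorm _).trans (lintegral_mono fun x => ?_)
  rw [enorm_smul]
  have : ‖fourier (k : ℤ) x‖ₑ = 1 := by
    rw [← ofReal_norm, norm_fourier_apply, ENNReal.ofReal_one]
  rw [this, mul_one]

/-! ### Free energies of positive definite potentials and their dual functional -/

/-- `W` is a positive definite potential, given by its cosine series
`W(x) = W₀ + ∑_{k ≥ 1} 2 w(k) cos (2πkx)` with `w(k) > 0`. The value `w 0` is set to `0`, so that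
sums over the nonconstant modes may be written over all of `ℕ`. -/
structure IsCosineSeries (W : C(UnitAddCircle, ℝ)) (w : ℕ → ℝ) (W₀ : ℝ) : Prop where
  zero : w 0 = 0
  pos : ∀ k, k ≠ 0 → 0 < w k
  summable : Summable w
  hasSum : ∀ x, HasSum (fun k : ℕ => 2 * w k * (fourier (k : ℤ) x).re) (W x - W₀)

/-- Sequences of Fourier modes bounded by `1`; it contains the modes of every probability
measure and is compact in the product topology. -/
def polydisc : Set (ℕ → ℂ) := {a | ∀ k, ‖a k‖ ≤ 1}

lemma isCompact_polydisc : IsCompact polydisc := by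
  have : polydisc = Set.pi Set.univ fun _ : ℕ => Metric.closedBall (0 : ℂ) 1 := by
    ext a; simp [polydisc]
  rw [this]
  exact isCompact_univ_pi fun _ => isCompact_closedBall _ _

lemma modeOf_mem_polydisc (q : ProbabilityMeasure UnitAddCircle) : modeOf q ∈ polydisc :=
  norm_modeOf_le q

/-- The quadratic form `∑ w(k) |a(k)|²`. -/
noncomputable def energy (w : ℕ → ℝ) (a : ℕ → ℂ) : ℝ := ∑' k, w k * ‖a k‖ ^ 2

/-- The real trigonometric monomial `Re (conj c · e^{2πikx})`. -/
noncomputable def harmonic (k : ℕ) (c : ℂ) : C(UnitAddCircle, ℝ) where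
  toFun x := ((starRingEnd ℂ) c * fourier (k : ℤ) x).re
  continuous_toFun := by fun_prop

/-- The potential `∑ 2 w(k) Re (conj a(k) e^{2πikx})`. For the modes `a` of a measure `q` it is
the mean-zero part of `W * q`. -/
noncomputable def field (w : ℕ → ℝ) (a : ℕ → ℂ) : C(UnitAddCircle, ℝ) :=
  ∑' k, (2 * w k) • harmonic k (a k)

lemma norm_harmonic_le (k : ℕ) (c : ℂ) : ‖harmonic k c‖ ≤ ‖c‖ := by
  refine (ContinuousMap.norm_le _ (norm_nonneg _)).2 fun x => ?_
  refine (Complex.abs_re_le_norm _).trans_eq ?_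
  rw [norm_mul, RCLike.norm_conj, norm_fourier_apply, mul_one]

lemma continuous_harmonic (k : ℕ) : Continuous (harmonic k) := by
  have hl : LipschitzWith 1 (harmonic k) := by
    refine LipschitzWith.of_dist_le_mul fun c d => ?_
    have : harmonic k c - harmonic k d = harmonic k (c - d) := by
      ext x; simp [harmonic, sub_mul]
    rw [dist_eq_norm, dist_eq_norm, this, NNReal.coe_one, one_mul]
    exact norm_harmonic_le _ _
  exact hl.continuous

/-- The log-partition function `log ∫ e^f`. -/
noncomputable def logPartition (f : C(UnitAddCircle, ℝ)) : ℝ := Real.log (∫ x, Real.exp (f x))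

lemma integral_exp_continuousMap_pos (f : C(UnitAddCircle, ℝ)) :
    0 < ∫ x, Real.exp (f x) :=
  integral_exp_pos (integrable_of_continuous _ (by fun_prop))

lemma continuous_logPartition : Continuous logPartition := by
  have h1 : LipschitzWith 1 fun g : C(UnitAddCircle, ℝ) => ∫ x, g x := by
    refine LipschitzWith.of_dist_le_mul fun f g => ?_
    rw [NNReal.coe_one, one_mul, dist_eq_norm, dist_eq_norm,
      ← integral_sub (integrable_of_continuous _ f.continuous)
        (integrable_of_continuous _ g.continuous)]
    refine (norm_integral_le_of_norm_le_const (C := ‖f - g‖)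
      (ae_of_all _ fun x => (f - g).norm_coe_le_norm x)).trans_eq ?_
    simp
  have h2 : Continuous fun f : C(UnitAddCircle, ℝ) =>
      (ContinuousMap.comp ⟨Real.exp, Real.continuous_exp⟩ f : C(UnitAddCircle, ℝ)) :=
    ContinuousMap.continuous_postcomp _
  exact (h1.continuous.comp h2).log fun f => (integral_exp_continuousMap_pos f).ne'

/-- The dual functional of the free energy. -/
noncomputable def dual (w : ℕ → ℝ) (K : ℝ) (a : ℕ → ℂ) : ℝ :=
  2 * K * energy w a - logPartition ((2 * K) • field w a)

/-- The free energy of `q` relative to that of the uniform distribution, for `q` of finite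
entropy. -/
noncomputable def excess (w : ℕ → ℝ) (K : ℝ) (q : ProbabilityMeasure UnitAddCircle) : ℝ :=
  (entropy q).toReal - 2 * K * energy w (modeOf q)

section

variable {W : C(UnitAddCircle, ℝ)} {w : ℕ → ℝ} {W₀ : ℝ}

lemma IsCosineSeries.nonneg (hw : IsCosineSeries W w W₀) (k : ℕ) : 0 ≤ w k := by
  rcases eq_or_ne k 0 with rfl | hk
  · exact hw.zero.ge
  · exact (hw.pos k hk).le

lemma IsCosineSeries.summable_energy (hw : IsCosineSeries W w W₀) {a : ℕ → ℂ} {B : ℝ}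
    (ha : ∀ k, ‖a k‖ ≤ B) : Summable fun k => w k * ‖a k‖ ^ 2 := by
  refine Summable.of_nonneg_of_le (fun k => mul_nonneg (hw.nonneg k) (sq_nonneg _))
    (fun k => ?_) (hw.summable.mul_right (B ^ 2))
  exact mul_le_mul_of_nonneg_left (pow_le_pow_left₀ (norm_nonneg _) (ha k) 2) (hw.nonneg k)

lemma IsCosineSeries.energy_nonneg (hw : IsCosineSeries W w W₀) (a : ℕ → ℂ) : 0 ≤ energy w a :=
  tsum_nonneg fun k => mul_nonneg (hw.nonneg k) (sq_nonneg _)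

lemma IsCosineSeries.energy_eq_zero (hw : IsCosineSeries W w W₀) {a : ℕ → ℂ} {B : ℝ}
    (ha : ∀ k, ‖a k‖ ≤ B) (h : energy w a = 0) {k : ℕ} (hk : k ≠ 0) : a k = 0 := by
  have hs := (hw.summable_energy ha).hasSum
  rw [← energy, h, hasSum_zero_iff_of_nonneg
    (fun k => mul_nonneg (hw.nonneg k) (sq_nonneg _))] at hs
  have := congrFun hs k
  simpa [(hw.pos k hk).ne'] using this

lemma IsCosineSeries.energy_uniform (hw : IsCosineSeries W w W₀) :
    energy w (modeOf uniform) = 0 := by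
  rw [energy, ← tsum_zero (α := ℝ) (β := ℕ)]
  refine tsum_congr fun k => ?_
  rcases eq_or_ne k 0 with rfl | hk
  · simp [hw.zero]
  · simp [modeOf_uniform hk]

lemma IsCosineSeries.continuousOn_energy (hw : IsCosineSeries W w W₀) :
    ContinuousOn (energy w) polydisc := by
  refine continuousOn_tsum (u := w) (fun k => by fun_prop) hw.summable fun k a ha => ?_
  rw [Real.norm_of_nonneg (mul_nonneg (hw.nonneg k) (sq_nonneg _))]
  exact mul_le_of_le_one_right (hw.nonneg k) (pow_le_one₀ (norm_nonneg _) (ha k))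

lemma IsCosineSeries.norm_field_term_le (hw : IsCosineSeries W w W₀) {a : ℕ → ℂ}
    (ha : a ∈ polydisc) (k : ℕ) : ‖(2 * w k) • harmonic k (a k)‖ ≤ 2 * w k := by
  have h0 : 0 ≤ 2 * w k := by linarith [hw.nonneg k]
  rw [norm_smul, Real.norm_of_nonneg h0]
  exact mul_le_of_le_one_right h0 ((norm_harmonic_le _ _).trans (ha k))

lemma IsCosineSeries.continuousOn_field (hw : IsCosineSeries W w W₀) :
    ContinuousOn (field w) polydisc := by
  refine continuousOn_tsum (u := fun k => 2 * w k) (fun k => ?_) (hw.summable.mul_left 2)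
    fun k a ha => hw.norm_field_term_le ha k
  have h1 : Continuous fun a : ℕ → ℂ => harmonic k (a k) :=
    (continuous_harmonic k).comp (continuous_apply k)
  exact (h1.const_smul (2 * w k)).continuousOn

lemma IsCosineSeries.hasSum_field (hw : IsCosineSeries W w W₀) {a : ℕ → ℂ}
    (ha : a ∈ polydisc) (x : UnitAddCircle) :
    HasSum (fun k : ℕ => 2 * w k * ((starRingEnd ℂ) (a k) * fourier (k : ℤ) x).re)
      (field w a x) := by
  have hs : Summable fun k => (2 * w k) • harmonic k (a k) :=
    Summable.of_norm_bounded (hw.summable.mul_left 2) (hw.norm_field_term_le ha)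
  exact ContinuousMap.hasSum_apply hs.hasSum x

lemma abs_field_term_le (hw : IsCosineSeries W w W₀) {a : ℕ → ℂ} (ha : a ∈ polydisc) (k : ℕ)
    (x : UnitAddCircle) :
    ‖2 * w k * ((starRingEnd ℂ) (a k) * fourier (k : ℤ) x).re‖ ≤ 2 * w k := by
  exact (ContinuousMap.norm_coe_le_norm ((2 * w k) • harmonic k (a k)) x).trans
    (hw.norm_field_term_le ha k)

lemma IsCosineSeries.hasSum_integral_field (hw : IsCosineSeries W w W₀) {a : ℕ → ℂ}
    (ha : a ∈ polydisc) (q : ProbabilityMeasure UnitAddCircle) :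
    HasSum (fun k : ℕ => 2 * w k * ((starRingEnd ℂ) (a k) * modeOf q k).re)
      (∫ x, field w a x ∂(q : Measure UnitAddCircle)) := by
  have h := hasSum_integral_of_bound (μ := (q : Measure UnitAddCircle))
    (φ := fun k x => 2 * w k * ((starRingEnd ℂ) (a k) * fourier (k : ℤ) x).re)
    (u := fun k => 2 * w k) (fun k => by fun_prop) (abs_field_term_le hw ha)
    (hw.summable.mul_left 2) (hw.hasSum_field ha)
  convert! h using 2 with k
  rw [integral_const_mul]
  congr 1
  have h1 := integral_re (integrable_of_continuous (q : Measure UnitAddCircle)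
    (f := fun x => (starRingEnd ℂ) (a k) * fourier (k : ℤ) x) (by fun_prop))
  rw [integral_const_mul] at h1
  exact h1.symm

lemma IsCosineSeries.integral_sub (hw : IsCosineSeries W w W₀)
    (q : ProbabilityMeasure UnitAddCircle) (x : UnitAddCircle) :
    ∫ y, W (x - y) ∂(q : Measure UnitAddCircle) = W₀ + field w (modeOf q) x := by
  have h := hasSum_integral_of_bound (μ := (q : Measure UnitAddCircle))
    (φ := fun k y => 2 * w k * (fourier (k : ℤ) (x - y)).re)
    (F := fun y => W (x - y) - W₀)
    (u := fun k => 2 * w k) (fun k => by fun_prop)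
    (fun k y => by
      have h0 : 0 ≤ 2 * w k := by linarith [hw.nonneg k]
      rw [norm_mul, Real.norm_of_nonneg h0]
      refine mul_le_of_le_one_right h0 ((Complex.abs_re_le_norm _).trans_eq ?_)
      rw [norm_fourier_apply])
    (hw.summable.mul_left 2) (fun y => hw.hasSum (x - y))
  have hk : ∀ k : ℕ, ∫ y, 2 * w k * (fourier (k : ℤ) (x - y)).re ∂(q : Measure UnitAddCircle) =
      2 * w k * ((starRingEnd ℂ) (modeOf q k) * fourier (k : ℤ) x).re := by
    intro k
    rw [integral_const_mul]
    congr 1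
    have he : ∀ y : UnitAddCircle, (fourier (k : ℤ) (x - y)).re =
        ((starRingEnd ℂ) (fourier (k : ℤ) x) * fourier (k : ℤ) y).re := by
      intro y
      rw [fourier_apply, sub_eq_add_neg, smul_add, smul_neg, AddCircle.toCircle_add,
        Circle.coe_mul, fourier_neg', ← fourier_apply]
      simp only [Complex.mul_re, Complex.conj_re, Complex.conj_im]
      ring
    simp only [he]
    have h1 := integral_re (integrable_of_continuous (q : Measure UnitAddCircle)
      (f := fun y => (starRingEnd ℂ) (fourier (k : ℤ) x) * fourier (k : ℤ) y) (by fun_prop))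
    rw [integral_const_mul] at h1
    refine h1.trans ?_
    change ((starRingEnd ℂ) (fourier (k : ℤ) x) * modeOf q k).re = _
    simp only [Complex.mul_re, Complex.conj_re, Complex.conj_im]
    ring
  simp only [hk] at h
  have h2 := h.unique (hw.hasSum_field (modeOf_mem_polydisc q) x)
  rw [MeasureTheory.integral_sub (integrable_of_continuous _ (by fun_prop))
    (integrable_const _)] at h2
  simp only [integral_const, probReal_univ, smul_eq_mul, one_mul] at h2
  linarith

lemma IsCosineSeries.integral_field_modeOf (hw : IsCosineSeries W w W₀)
    (q : ProbabilityMeasure UnitAddCircle) :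
    ∫ x, field w (modeOf q) x ∂(q : Measure UnitAddCircle) = 2 * energy w (modeOf q) := by
  have h1 := hw.hasSum_integral_field (modeOf_mem_polydisc q) q
  have h2 := (hw.summable_energy (norm_modeOf_le q)).hasSum.mul_left 2
  refine h1.unique ?_
  convert! h2 using 2 with k
  rw [← Complex.normSq_eq_conj_mul_self, Complex.ofReal_re, Complex.normSq_eq_norm_sq]
  ring

lemma IsCosineSeries.freeEnergy_eq (hw : IsCosineSeries W w W₀) (K : ℝ)
    (q : ProbabilityMeasure UnitAddCircle) :
    freeEnergy W K q =
      (entropy q : EReal) - ((K * W₀ + 2 * K * energy w (modeOf q) : ℝ) : EReal) := by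
  have : ∫ x, ∫ y, W (x - y) ∂(q : Measure UnitAddCircle) ∂(q : Measure UnitAddCircle) =
      W₀ + 2 * energy w (modeOf q) := by
    simp only [hw.integral_sub]
    rw [integral_add (integrable_const _)
      (integrable_of_continuous _ (field w (modeOf q)).continuous), hw.integral_field_modeOf]
    simp
  rw [freeEnergy, this, entropy]
  congr 2
  ring

lemma IsCosineSeries.freeEnergy_eq_excess (hw : IsCosineSeries W w W₀) (K : ℝ)
    {q : ProbabilityMeasure UnitAddCircle} (hq : entropy q ≠ ∞) :
    freeEnergy W K q = ((excess w K q - K * W₀ : ℝ) : EReal) := by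
  rw [hw.freeEnergy_eq, excess]
  lift entropy q to NNReal using hq with e
  rw [← EReal.coe_ennreal_toReal ENNReal.coe_ne_top, ← EReal.coe_sub]
  congr 1
  ring

lemma IsCosineSeries.isGlobalMinimizer_iff (hw : IsCosineSeries W w W₀) {K : ℝ}
    {q : ProbabilityMeasure UnitAddCircle} :
    IsGlobalMinimizer W K q ↔
      entropy q ≠ ∞ ∧ ∀ p, entropy p ≠ ∞ → excess w K q ≤ excess w K p := by
  constructor
  · intro h
    have hq : entropy q ≠ ∞ := by
      intro hq
      have := h uniform
      rw [hw.freeEnergy_eq_excess K (q := uniform) (by simp [entropy_uniform]),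
        hw.freeEnergy_eq, hq, EReal.coe_ennreal_top, EReal.top_sub_coe] at this
      exact absurd this (not_le.2 (EReal.coe_lt_top _))
    refine ⟨hq, fun p hp => ?_⟩
    have := h p
    rw [hw.freeEnergy_eq_excess K hq, hw.freeEnergy_eq_excess K hp, EReal.coe_le_coe_iff] at this
    linarith
  · rintro ⟨hq, h⟩ p
    by_cases hp : entropy p = ∞
    · rw [hw.freeEnergy_eq K p, hp, EReal.coe_ennreal_top, EReal.top_sub_coe]
      exact le_top
    · rw [hw.freeEnergy_eq_excess K hq, hw.freeEnergy_eq_excess K hp, EReal.coe_le_coe_iff]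
      linarith [h p hp]

lemma IsCosineSeries.excess_uniform (hw : IsCosineSeries W w W₀) (K : ℝ) :
    excess w K uniform = 0 := by
  rw [excess, hw.energy_uniform, entropy_uniform]; simp

lemma IsCosineSeries.isGlobalMinimizer_uniform_iff (hw : IsCosineSeries W w W₀) {K : ℝ} :
    IsGlobalMinimizer W K uniform ↔ ∀ p, entropy p ≠ ∞ → 0 ≤ excess w K p := by
  rw [hw.isGlobalMinimizer_iff, hw.excess_uniform]
  exact and_iff_right (by simp [entropy_uniform])

lemma IsCosineSeries.continuousOn_dual (hw : IsCosineSeries W w W₀) :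
    ContinuousOn (fun p : ℝ × (ℕ → ℂ) => dual w p.1 p.2) (Set.univ ×ˢ polydisc) := by
  have h2 : Set.MapsTo Prod.snd ((Set.univ : Set ℝ) ×ˢ polydisc) polydisc := fun p hp => hp.2
  refine ContinuousOn.sub ?_ ?_
  · exact (by fun_prop : Continuous fun p : ℝ × (ℕ → ℂ) => 2 * p.1).continuousOn.mul
      (hw.continuousOn_energy.comp continuous_snd.continuousOn h2)
  · refine continuous_logPartition.comp_continuousOn ?_
    exact (by fun_prop : Continuous fun p : ℝ × (ℕ → ℂ) => 2 * p.1).continuousOn.smul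
      (hw.continuousOn_field.comp continuous_snd.continuousOn h2)

/-- The dual functional is a lower bound for the free energy. -/
lemma IsCosineSeries.dual_le_excess (hw : IsCosineSeries W w W₀) (K : ℝ)
    {q : ProbabilityMeasure UnitAddCircle} (hq : entropy q ≠ ∞) :
    dual w K (modeOf q) ≤ excess w K q := by
  have h := integral_sub_log_le_entropy hq ((2 * K) • field w (modeOf q)).continuous
  simp only [ContinuousMap.smul_apply, smul_eq_mul] at h
  rw [integral_const_mul, hw.integral_field_modeOf] at h
  rw [dual, excess, logPartition]
  simp only [ContinuousMap.smul_apply, smul_eq_mul]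
  linarith

/-- The dual functional at `a` bounds the free energy of the Gibbs measure with potential
`2 K field a` from above, with a defect that controls the distance of `a` to its modes. -/
lemma IsCosineSeries.excess_gibbs_add (hw : IsCosineSeries W w W₀) (K : ℝ) {a : ℕ → ℂ}
    (ha : a ∈ polydisc) :
    excess w K (gibbs ((2 * K) • field w a)) +
      2 * K * energy w (modeOf (gibbs ((2 * K) • field w a)) - a) = dual w K a := by
  set q := gibbs ((2 * K) • field w a) with hq
  have h := (entropy_gibbs ((2 * K) • field w a)).2
  rw [← hq] at h
  simp only [ContinuousMap.smul_apply, smul_eq_mul] at h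
  rw [integral_const_mul] at h
  have h1 := hw.hasSum_integral_field ha q
  have h2 := (hw.summable_energy (norm_modeOf_le q)).hasSum
  have h3 := (hw.summable_energy ha).hasSum
  have hb : ∀ k, ‖(modeOf q - a) k‖ ≤ 1 + 1 := fun k =>
    (norm_sub_le _ _).trans (add_le_add (norm_modeOf_le q k) (ha k))
  have h4 := (hw.summable_energy hb).hasSum
  have h5 : energy w (modeOf q - a) = energy w (modeOf q) + energy w a -
      ∫ x, field w a x ∂(q : Measure UnitAddCircle) := by
    refine h4.unique ?_
    convert! (h2.add h3).sub h1 using 2 with k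
    simp only [Pi.sub_apply, ← Complex.normSq_eq_norm_sq]
    rw [Complex.normSq_sub, mul_comm ((starRingEnd ℂ) (a k))]
    ring
  rw [excess, h, h5, dual, logPartition]
  simp only [ContinuousMap.smul_apply, smul_eq_mul]
  ring

lemma IsCosineSeries.excess_gibbs_le (hw : IsCosineSeries W w W₀) {K : ℝ} (hK : 0 ≤ K)
    {a : ℕ → ℂ} (ha : a ∈ polydisc) :
    excess w K (gibbs ((2 * K) • field w a)) ≤ dual w K a := by
  rw [← hw.excess_gibbs_add K ha]
  have := hw.energy_nonneg (modeOf (gibbs ((2 * K) • field w a)) - a)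
  have : 0 ≤ 2 * K * energy w (modeOf (gibbs ((2 * K) • field w a)) - a) := by positivity
  linarith

lemma IsCosineSeries.exists_isGlobalMinimizer (hw : IsCosineSeries W w W₀) {K : ℝ}
    (hK : 0 ≤ K) : ∃ q, IsGlobalMinimizer W K q := by
  have hc : ContinuousOn (dual w K) polydisc :=
    hw.continuousOn_dual.comp (f := fun a => (K, a)) (by fun_prop) fun a ha => ⟨trivial, ha⟩
  obtain ⟨a, ha, hmin⟩ := isCompact_polydisc.exists_isMinOn
    ⟨modeOf uniform, modeOf_mem_polydisc _⟩ hc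
  refine ⟨gibbs ((2 * K) • field w a), hw.isGlobalMinimizer_iff.2
    ⟨(entropy_gibbs _).1, fun p hp => ?_⟩⟩
  exact (hw.excess_gibbs_le hK ha).trans
    ((hmin (modeOf_mem_polydisc p)).trans (hw.dual_le_excess K hp))

end

/-! ### Critical coupling, stability thresholds and continuous transitions -/

section

variable {W : C(UnitAddCircle, ℝ)} {w : ℕ → ℝ} {W₀ : ℝ}

lemma entropy_eq_zero_of_toReal_nonpos {q : ProbabilityMeasure UnitAddCircle}
    (hq : entropy q ≠ ∞) (h : (entropy q).toReal ≤ 0) : q = uniform :=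
  entropy_eq_zero_iff.1 (((ENNReal.toReal_eq_zero_iff _).1
    (le_antisymm h ENNReal.toReal_nonneg)).resolve_right hq)

lemma IsCosineSeries.entropy_le_of_isGlobalMinimizer (hw : IsCosineSeries W w W₀) {K : ℝ}
    {q : ProbabilityMeasure UnitAddCircle} (h : IsGlobalMinimizer W K q) :
    (entropy q).toReal ≤ 2 * K * energy w (modeOf q) := by
  have := (hw.isGlobalMinimizer_iff.1 h).2 uniform (by simp [entropy_uniform])
  rw [hw.excess_uniform, excess] at this
  linarith

lemma IsCosineSeries.isGlobalMinimizer_uniform_mono (hw : IsCosineSeries W w W₀) {K L : ℝ}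
    (hKL : K ≤ L) (h : IsGlobalMinimizer W L uniform) : IsGlobalMinimizer W K uniform := by
  rw [hw.isGlobalMinimizer_uniform_iff] at h ⊢
  intro p hp
  refine (h p hp).trans ?_
  have := hw.energy_nonneg (modeOf p)
  rw [excess, excess]
  nlinarith

/-- The critical coupling is the largest `K` for which the uniform distribution is a
minimizer. -/
lemma IsCosineSeries.exists_isCriticalCoupling (hw : IsCosineSeries W w W₀) {K₀ K₁ : ℝ}
    (hK₀ : 0 < K₀) (h₀ : IsGlobalMinimizer W K₀ uniform) (h₁ : ¬ IsGlobalMinimizer W K₁ uniform) :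
    ∃ Kc, IsCriticalCoupling W Kc ∧ K₀ ≤ Kc := by
  set A : Set ℝ := {K | IsGlobalMinimizer W K uniform} with hA
  have hbdd : BddAbove A := ⟨K₁, fun K hK => by
    by_contra hlt
    exact h₁ (hw.isGlobalMinimizer_uniform_mono (not_le.1 hlt).le hK)⟩
  have hle : K₀ ≤ sSup A := le_csSup hbdd h₀
  have hcrit : IsGlobalMinimizer W (sSup A) uniform := by
    rw [hw.isGlobalMinimizer_uniform_iff]
    intro p hp
    by_contra hneg
    rw [not_le, excess] at hneg
    have hen := hw.energy_nonneg (modeOf p)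
    have hE : 0 ≤ (entropy p).toReal := ENNReal.toReal_nonneg
    have hen' : 0 < energy w (modeOf p) := by
      refine hen.lt_of_ne fun h => ?_
      rw [← h] at hneg
      linarith
    have hlt : (entropy p).toReal / (2 * energy w (modeOf p)) < sSup A := by
      rw [div_lt_iff₀ (by positivity)]
      linarith
    obtain ⟨K, hK, hKlt⟩ := exists_lt_of_lt_csSup ⟨K₀, h₀⟩ hlt
    have := hw.isGlobalMinimizer_uniform_iff.1 hK p hp
    rw [div_lt_iff₀ (by positivity)] at hKlt
    rw [excess] at this
    linarith
  refine ⟨sSup A, ⟨hK₀.trans_le hle, ?_, hcrit, ?_⟩, hle⟩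
  · intro K hK hlt q
    constructor
    · intro hq
      have hfin := (hw.isGlobalMinimizer_iff.1 hq).1
      have h1 := hw.entropy_le_of_isGlobalMinimizer hq
      have h2 := hw.isGlobalMinimizer_uniform_iff.1 hcrit q hfin
      have h3 := hw.energy_nonneg (modeOf q)
      rw [excess] at h2
      have h4 : energy w (modeOf q) ≤ 0 := by
        by_contra h
        nlinarith [not_le.1 h]
      refine entropy_eq_zero_of_toReal_nonpos hfin ?_
      nlinarith
    · rintro rfl
      exact hw.isGlobalMinimizer_uniform_mono hlt.le hcrit
  · intro K hK
    obtain ⟨q, hq⟩ := hw.exists_isGlobalMinimizer ((hK₀.trans_le hle).trans hK).le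
    refine ⟨q, ?_, hq⟩
    rintro rfl
    exact absurd (le_csSup hbdd hq) (not_le.2 hK)

/-- If `2 K w(k) ≤ 1 / k`, the logarithmic Hardy–Littlewood–Sobolev inequality bounds the
interaction by the entropy. -/
lemma IsCosineSeries.isGlobalMinimizer_uniform_of_le (hw : IsCosineSeries W w W₀) {K : ℝ}
    (hK : 0 ≤ K) (h : ∀ k : ℕ, 2 * K * w k ≤ 1 / k) :
    IsGlobalMinimizer W K uniform := by
  rw [hw.isGlobalMinimizer_uniform_iff]
  intro q hq
  rw [excess, sub_nonneg, energy, ← tsum_mul_left]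
  refine Real.tsum_le_of_sum_range_le (fun k => ?_) fun N => ?_
  · have := hw.nonneg k
    positivity
  · refine le_trans ?_ (sum_norm_modeOf_sq_div_le hq N.succ_pos)
    refine (Finset.sum_le_sum (g := fun k : ℕ => ‖modeOf q k‖ ^ 2 / k) fun k _ => ?_).trans
      (Finset.sum_le_sum_of_subset_of_nonneg (Finset.range_mono N.le_succ)
        fun k _ _ => by positivity)
    calc 2 * K * (w k * ‖modeOf q k‖ ^ 2) = (2 * K * w k) * ‖modeOf q k‖ ^ 2 := by ring
      _ ≤ 1 / k * ‖modeOf q k‖ ^ 2 := by gcongr; exact h k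
      _ = ‖modeOf q k‖ ^ 2 / k := by ring

/-- If `2 K w(k) ≤ 1 / k`, strictly for `k ≥ 3`, then a minimizer has modes of order at most two
only, for which the logarithmic Hardy–Littlewood–Sobolev inequality is strict. -/
lemma IsCosineSeries.eq_uniform_of_le (hw : IsCosineSeries W w W₀) {K : ℝ}
    (h : ∀ k : ℕ, 2 * K * w k ≤ 1 / k) (h3 : ∀ k : ℕ, 3 ≤ k → 2 * K * w k < 1 / k)
    {q : ProbabilityMeasure UnitAddCircle} (hq : IsGlobalMinimizer W K q) : q = uniform := by
  have hfin := (hw.isGlobalMinimizer_iff.1 hq).1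
  have hle := hw.entropy_le_of_isGlobalMinimizer hq
  have hs1 : Summable fun k : ℕ => ‖modeOf q k‖ ^ 2 / k := by
    refine summable_of_sum_range_le (c := (entropy q).toReal) (fun k => by positivity) fun N => ?_
    exact (Finset.sum_le_sum_of_subset_of_nonneg (Finset.range_mono N.le_succ)
        fun k _ _ => by positivity).trans (sum_norm_modeOf_sq_div_le hfin N.succ_pos)
  have ht1 : ∑' k : ℕ, ‖modeOf q k‖ ^ 2 / k ≤ (entropy q).toReal := by
    refine Real.tsum_le_of_sum_range_le (fun k => by positivity) fun N => ?_
    exact (Finset.sum_le_sum_of_subset_of_nonneg (Finset.range_mono N.le_succ)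
        fun k _ _ => by positivity).trans (sum_norm_modeOf_sq_div_le hfin N.succ_pos)
  have hs2 := (hw.summable_energy (norm_modeOf_le q)).mul_left (2 * K)
  have hd : ∀ k : ℕ, 0 ≤ ‖modeOf q k‖ ^ 2 / k - 2 * K * (w k * ‖modeOf q k‖ ^ 2) := by
    intro k
    have := mul_le_mul_of_nonneg_right (h k) (sq_nonneg ‖modeOf q k‖)
    rw [one_div_mul_eq_div] at this
    linarith
  have hsum := hs1.hasSum.sub hs2.hasSum
  have hzero : HasSum
      (fun k : ℕ => ‖modeOf q k‖ ^ 2 / k - 2 * K * (w k * ‖modeOf q k‖ ^ 2)) 0 := by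
    convert! hsum using 1
    refine le_antisymm (hsum.nonneg hd) ?_
    rw [tsum_mul_left, ← energy]
    linarith
  rw [hasSum_zero_iff_of_nonneg hd] at hzero
  have hmode : ∀ k : ℕ, 3 ≤ k → modeOf q k = 0 := by
    intro k hk
    by_contra hne
    have h1 := congrFun hzero k
    have h2 := mul_lt_mul_of_pos_right (h3 k hk)
      (show 0 < ‖modeOf q k‖ ^ 2 by have := norm_pos_iff.2 hne; positivity)
    rw [one_div_mul_eq_div] at h2
    simp only [Pi.zero_apply] at h1
    linarith
  have hen : energy w (modeOf q) = w 1 * ‖modeOf q 1‖ ^ 2 + w 2 * ‖modeOf q 2‖ ^ 2 := by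
    rw [energy, tsum_eq_sum (s := Finset.range 3) fun k hk => by
      rw [hmode k (by simpa using hk)]; simp]
    simp [Finset.sum_range_succ, hw.zero]
  have h1 := hd 1
  have h2 := hd 2
  push_cast at h1 h2
  by_cases h12 : modeOf q 1 ≠ 0 ∨ modeOf q 2 ≠ 0
  · have := norm_modeOf_sq_add_lt hfin h12
    rw [hen] at hle
    linarith
  · push Not at h12
    refine entropy_eq_zero_of_toReal_nonpos hfin (hle.trans_eq ?_)
    rw [hen, h12.1, h12.2]
    simp

/-- The sequence of modes with entries `r`, `s` at `k = 1, 2`. -/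
noncomputable def twoMode (r s : ℝ) (k : ℕ) : ℂ := if k = 1 then r else if k = 2 then s else 0

lemma twoMode_mem_polydisc {r s : ℝ} (hr : |r| ≤ 1) (hs : |s| ≤ 1) :
    twoMode r s ∈ polydisc := by
  intro k
  rw [twoMode]
  split_ifs
  · simpa using hr
  · simpa using hs
  · simp

/-- A bound on the dual functional from the first three terms of
`∫ exp (2 Re h) = ∑ |c n|²`. -/
lemma IsCosineSeries.dual_twoMode_le (hw : IsCosineSeries W w W₀) (K : ℝ) {r s : ℝ}
    (hr : |r| ≤ 1) (hs : |s| ≤ 1) :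
    dual w K (twoMode r s) ≤ 2 * K * w 1 * r ^ 2 + 2 * K * w 2 * s ^ 2 -
      Real.log (1 + (2 * K * w 1 * r) ^ 2 +
        (2 * K * w 2 * s + (2 * K * w 1 * r) ^ 2 / 2) ^ 2) := by
  have h0 : ∀ k ∉ Finset.range 3, twoMode r s k = 0 := by
    intro k hk
    have : 3 ≤ k := by simpa using hk
    rw [twoMode, if_neg (by omega), if_neg (by omega)]
  have hen : energy w (twoMode r s) = w 1 * r ^ 2 + w 2 * s ^ 2 := by
    rw [energy, tsum_eq_sum (s := Finset.range 3) fun k hk => by rw [h0 k hk]; simp]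
    simp [Finset.sum_range_succ, twoMode]
  set h : ℕ → ℂ := fun k => ((2 * K * w k : ℝ) : ℂ) * twoMode r s k with hh
  have hf : ∀ x, ((2 * K) • field w (twoMode r s)) x =
      2 * (∑ k ∈ Finset.range 3, h k * fourier (k : ℤ) x).re := by
    intro x
    have h1 := (hw.hasSum_field (twoMode_mem_polydisc hr hs) x).unique
      (hasSum_sum_of_ne_finset_zero (s := Finset.range 3) fun k hk => by rw [h0 k hk]; simp)
    rw [ContinuousMap.smul_apply, smul_eq_mul, h1, Complex.re_sum, Finset.mul_sum, Finset.mul_sum]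
    refine Finset.sum_congr rfl fun k _ => ?_
    have hreal : (starRingEnd ℂ) (twoMode r s k) = twoMode r s k := by
      rw [twoMode]; split_ifs <;> simp
    rw [hreal, hh]
    simp only
    have : (((2 * K * w k : ℝ) : ℂ) * twoMode r s k * fourier (k : ℤ) x).re =
        2 * K * w k * (twoMode r s k * fourier (k : ℤ) x).re := by
      rw [mul_assoc, Complex.re_ofReal_mul]
    rw [this]
    ring
  have h2 := le_integral_exp_sum h (by simp [hh, twoMode])
  have e1 : ‖h 1‖ ^ 2 = (2 * K * w 1 * r) ^ 2 := by
    simp only [hh, twoMode, if_true]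
    rw [← Complex.ofReal_mul, Complex.norm_real, Real.norm_eq_abs, sq_abs]
  have e2 : ‖h 2 + h 1 ^ 2 / 2‖ ^ 2 = (2 * K * w 2 * s + (2 * K * w 1 * r) ^ 2 / 2) ^ 2 := by
    have : h 2 + h 1 ^ 2 / 2 = ((2 * K * w 2 * s + (2 * K * w 1 * r) ^ 2 / 2 : ℝ) : ℂ) := by
      simp [hh, twoMode]
    rw [this, Complex.norm_real, Real.norm_eq_abs, sq_abs]
  rw [e1, e2] at h2
  have h3 := Real.log_le_log (by positivity) h2
  rw [dual, logPartition, hen]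
  simp only [hf]
  linarith

lemma IsCosineSeries.not_isGlobalMinimizer_of_dual_neg (hw : IsCosineSeries W w W₀) {K : ℝ}
    (hK : 0 ≤ K) {a : ℕ → ℂ} (ha : a ∈ polydisc) (h : dual w K a < 0) :
    ¬ IsGlobalMinimizer W K uniform := by
  intro hmin
  have h1 := hw.isGlobalMinimizer_uniform_iff.1 hmin _ (entropy_gibbs ((2 * K) • field w a)).1
  linarith [hw.excess_gibbs_le hK ha]

/-- Beyond the linear stability threshold of the first mode, the uniform distribution is not a
minimizer. -/
lemma IsCosineSeries.not_isGlobalMinimizer_of_one_lt (hw : IsCosineSeries W w W₀) {K : ℝ}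
    (hK : 0 ≤ K) (h : 1 < 2 * K * w 1) : ¬ IsGlobalMinimizer W K uniform := by
  set l := 2 * K * w 1 with hl
  set r := Real.sqrt ((l - 1) / (2 * l ^ 2)) with hr
  have hl0 : 0 < l := by linarith
  have hr2 : r ^ 2 = (l - 1) / (2 * l ^ 2) :=
    Real.sq_sqrt (div_nonneg (by linarith) (by positivity))
  have hrpos : 0 < r ^ 2 := by rw [hr2]; exact div_pos (by linarith) (by positivity)
  have hlr : l ^ 2 * r ^ 2 = (l - 1) / 2 := by rw [hr2]; field_simp
  have hr1 : |r| ≤ 1 := by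
    rw [← sq_le_one_iff_abs_le_one, hr2, div_le_one (by positivity)]
    nlinarith
  refine hw.not_isGlobalMinimizer_of_dual_neg hK
    (twoMode_mem_polydisc hr1 (s := 0) (by simp)) ?_
  refine (hw.dual_twoMode_le K hr1 (s := 0) (by simp)).trans_lt ?_
  rw [← hl]
  have h1 : 1 + l ^ 2 * r ^ 2 ≤
      1 + (l * r) ^ 2 + (2 * K * w 2 * 0 + (l * r) ^ 2 / 2) ^ 2 := by
    nlinarith [sq_nonneg ((l * r) ^ 2 / 2)]
  have hX : 0 < 1 + l ^ 2 * r ^ 2 := by positivity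
  have h2 := Real.log_le_log hX h1
  have h3 := Real.one_sub_inv_le_log_of_pos hX
  have h4 : l * r ^ 2 < 1 - (1 + l ^ 2 * r ^ 2)⁻¹ := by
    have : 1 - (1 + l ^ 2 * r ^ 2)⁻¹ = l ^ 2 * r ^ 2 / (1 + l ^ 2 * r ^ 2) := by
      field_simp; ring
    rw [this, lt_div_iff₀ hX, hlr]
    have e : l * r ^ 2 * (1 + (l - 1) / 2) < l * r ^ 2 * l := by
      refine mul_lt_mul_of_pos_left (by linarith) (by positivity)
    linarith [e, hlr]
  linarith

/-- At the linear stability threshold of the first mode, a second mode of more than half the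
strength destabilizes the uniform distribution: with `a = (r, r²)` the dual functional is
`r⁴ (1 / 4 - v²) + O(r⁶)` with `v = w(2) / w(1)`. -/
lemma IsCosineSeries.not_isGlobalMinimizer_of_half_lt (hw : IsCosineSeries W w W₀) {K : ℝ}
    (hK : 0 ≤ K) (h1 : 2 * K * w 1 = 1) (h2 : 1 / 2 < 2 * K * w 2) :
    ¬ IsGlobalMinimizer W K uniform := by
  set v := 2 * K * w 2 with hv
  obtain ⟨r, hr0, hr1, hr⟩ : ∃ r : ℝ, 0 < r ∧ r ≤ 1 ∧
      (1 + (v + 1 / 2) ^ 2 * r ^ 2) ^ 2 / 2 < v ^ 2 + 1 / 4 := by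
    have hc : Tendsto (fun r : ℝ => (1 + (v + 1 / 2) ^ 2 * r ^ 2) ^ 2 / 2) (𝓝[>] 0)
        (𝓝 ((1 + (v + 1 / 2) ^ 2 * 0 ^ 2) ^ 2 / 2)) :=
      tendsto_nhdsWithin_of_tendsto_nhds (Continuous.tendsto (by fun_prop) 0)
    have hlt : (1 + (v + 1 / 2) ^ 2 * 0 ^ 2) ^ 2 / 2 < v ^ 2 + 1 / 4 := by nlinarith
    obtain ⟨r, hr, hr'⟩ := ((hc.eventually_lt_const hlt).and
      (Ioo_mem_nhdsGT (zero_lt_one' ℝ))).exists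
    exact ⟨r, hr'.1, hr'.2.le, hr⟩
  have ha : |r| ≤ 1 := by rwa [abs_of_pos hr0]
  have hb : |r ^ 2| ≤ 1 := by rw [abs_of_pos (by positivity)]; exact pow_le_one₀ hr0.le hr1
  refine hw.not_isGlobalMinimizer_of_dual_neg hK (twoMode_mem_polydisc ha hb) ?_
  refine (hw.dual_twoMode_le K ha hb).trans_lt ?_
  rw [h1, ← hv]
  set X := r ^ 2 + (v * r ^ 2 + r ^ 2 / 2) ^ 2 with hX
  have hX0 : 0 ≤ X := by positivity
  have h3 := Real.le_log_one_add_of_nonneg hX0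
  have h4 : X - X ^ 2 / 2 ≤ 2 * X / (X + 2) := by
    rw [le_div_iff₀ (by positivity)]
    nlinarith [pow_nonneg hX0 3]
  have h5 : 1 + (1 * r) ^ 2 + (v * r ^ 2 + (1 * r) ^ 2 / 2) ^ 2 = 1 + X := by rw [hX]; ring
  have h6 : X = r ^ 2 * (1 + (v + 1 / 2) ^ 2 * r ^ 2) := by rw [hX]; ring
  have h7 := mul_lt_mul_of_pos_left hr (by positivity : 0 < r ^ 4)
  have h8 : X ^ 2 / 2 < r ^ 4 * (v ^ 2 + 1 / 4) := by
    refine lt_of_eq_of_lt ?_ h7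
    rw [h6]; ring
  rw [h5]
  have h9 : X - r ^ 2 - v * r ^ 4 = r ^ 4 * (v ^ 2 + 1 / 4) := by rw [hX]; ring
  nlinarith

/-- If the uniform distribution is the only minimizer at `Kc`, then the minimizers for `K ↓ Kc`
converge to it: limit points of their modes minimize the dual functional at `Kc`. -/
lemma IsCosineSeries.isContinuousTransition (hw : IsCosineSeries W w W₀) {Kc : ℝ}
    (hKc : 0 < Kc) (hmin : IsGlobalMinimizer W Kc uniform)
    (huniq : ∀ q, IsGlobalMinimizer W Kc q → q = uniform) : IsContinuousTransition W Kc := by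
  refine ⟨⟨uniform, hmin, huniq⟩, fun q hq => ?_⟩
  have hen : Tendsto (fun K => energy w (modeOf (q K))) (𝓝[>] Kc) (𝓝 0) := by
    rw [tendsto_iff_ultrafilter]
    intro U hU
    obtain ⟨b, hb, hUb⟩ := isCompact_polydisc.ultrafilter_le_nhds
      (U.map fun K : ℝ => modeOf (q K)) (by
        rw [le_principal_iff]
        exact Ultrafilter.mem_map.2 (Filter.univ_mem' fun K => modeOf_mem_polydisc (q K)))
    have ht : Tendsto (fun K => modeOf (q K)) U (𝓝[polydisc] b) :=
      tendsto_nhdsWithin_iff.2 ⟨hUb, Eventually.of_forall fun K => modeOf_mem_polydisc (q K)⟩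
    have hK : Tendsto (fun K : ℝ => K) U (𝓝 Kc) := hU.trans nhdsWithin_le_nhds
    have hdual : dual w Kc b ≤ 0 := by
      have hc := hw.continuousOn_dual (Kc, b) ⟨trivial, hb⟩
      have hp : Tendsto (fun K => (K, modeOf (q K))) U (𝓝[Set.univ ×ˢ polydisc] (Kc, b)) :=
        tendsto_nhdsWithin_iff.2 ⟨hK.prodMk_nhds hUb,
          Eventually.of_forall fun K => ⟨trivial, modeOf_mem_polydisc (q K)⟩⟩
      refine le_of_tendsto (hc.tendsto.comp hp) ?_
      filter_upwards [hU self_mem_nhdsWithin] with K hKmem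
      have hqK := hw.isGlobalMinimizer_iff.1 (hq K hKmem)
      have h1 := hw.entropy_le_of_isGlobalMinimizer (hq K hKmem)
      have h2 := hw.dual_le_excess K hqK.1
      rw [excess] at h2
      simp only [Function.comp]
      linarith
    have hadd := hw.excess_gibbs_add Kc hb
    set g := gibbs ((2 * Kc) • field w b) with hg
    have hgfin : entropy g ≠ ∞ := (entropy_gibbs _).1
    have h1 := hw.isGlobalMinimizer_uniform_iff.1 hmin
    have h2 := hw.energy_nonneg (modeOf g - b)
    have h3 : 0 ≤ 2 * Kc * energy w (modeOf g - b) := by positivity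
    have hgu : g = uniform := by
      refine huniq g (hw.isGlobalMinimizer_iff.2 ⟨hgfin, fun p hp => ?_⟩)
      linarith [h1 p hp]
    have h4 : energy w (modeOf g - b) = 0 := by
      have h5 := h1 g hgfin
      have h6 : 2 * Kc * energy w (modeOf g - b) ≤ 0 := by linarith
      nlinarith
    have hbk : ∀ k : ℕ, k ≠ 0 → b k = 0 := by
      intro k hk
      have := hw.energy_eq_zero (B := 1 + 1) (fun k => (norm_sub_le _ _).trans
        (add_le_add (norm_modeOf_le g k) (hb k))) h4 hk
      rw [hgu] at this
      simpa [modeOf_uniform hk] using this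
    have hb0 : energy w b = 0 := by
      rw [energy, ← tsum_zero (α := ℝ) (β := ℕ)]
      refine tsum_congr fun k => ?_
      rcases eq_or_ne k 0 with rfl | hk
      · simp [hw.zero]
      · simp [hbk k hk]
    rw [← hb0]
    exact (hw.continuousOn_energy b hb).tendsto.comp ht
  have hent : Tendsto (fun K => 2 * K * energy w (modeOf (q K))) (𝓝[>] Kc) (𝓝 0) := by
    have h1 : Tendsto (fun K : ℝ => 2 * K) (𝓝[>] Kc) (𝓝 (2 * Kc)) :=
      tendsto_nhdsWithin_of_tendsto_nhds (Continuous.tendsto (by fun_prop) Kc)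
    simpa using h1.mul hen
  refine Tendsto.limsup_eq (ENNReal.tendsto_nhds_zero.2 fun ε hε => ?_)
  obtain ⟨t, ht0, ht1, htε⟩ : ∃ t : ℝ, 0 < t ∧ t ≤ 1 ∧ ENNReal.ofReal (t + t) ≤ ε := by
    have hc : Tendsto (fun t : ℝ => ENNReal.ofReal (t + t)) (𝓝[>] 0) (𝓝 (ENNReal.ofReal (0 + 0))) :=
      tendsto_nhdsWithin_of_tendsto_nhds
        (Continuous.tendsto (ENNReal.continuous_ofReal.comp (by fun_prop)) 0)
    obtain ⟨t, ht, ht'⟩ := ((hc.eventually_lt_const (u := ε) (by simpa using hε)).and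
      (Ioo_mem_nhdsGT (zero_lt_one' ℝ))).exists
    exact ⟨t, ht'.1, ht'.2.le, ht.le⟩
  filter_upwards [hent.eventually_lt_const (by positivity : 0 < t ^ 2), self_mem_nhdsWithin]
    with K hK hKc'
  have hqK := hw.isGlobalMinimizer_iff.1 (hq K hKc')
  have h1 := hw.entropy_le_of_isGlobalMinimizer (hq K hKc')
  refine (l1DistUniform_le hqK.1 ht0 ht1).trans (le_trans (ENNReal.ofReal_le_ofReal ?_) htε)
  have : (entropy (q K)).toReal / t ≤ t := by
    rw [div_le_iff₀ ht0]
    nlinarith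
  linarith

end

/-! ### Local stability and discontinuous transitions -/

section

variable {W : C(UnitAddCircle, ℝ)} {w : ℕ → ℝ} {W₀ : ℝ}

lemma IsCosineSeries.integral_field (hw : IsCosineSeries W w W₀) {a : ℕ → ℂ}
    (ha : a ∈ polydisc) : ∫ x, field w a x = 0 := by
  have h := hw.hasSum_integral_field ha uniform
  refine h.unique ?_
  convert! hasSum_zero (α := ℝ) (β := ℕ) using 2 with k
  rcases eq_or_ne k 0 with rfl | hk
  · simp [hw.zero]
  · simp [modeOf_uniform hk]

lemma integral_re_mul_fourier (c : ℂ) {j k : ℕ} (hk : k ≠ 0) :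
    ∫ x : UnitAddCircle, ((((starRingEnd ℂ) c * fourier (j : ℤ) x).re : ℝ) : ℂ) *
      fourier (k : ℤ) x = if j = k then c / 2 else 0 := by
  have he : ∀ x : UnitAddCircle, ((((starRingEnd ℂ) c * fourier (j : ℤ) x).re : ℝ) : ℂ) *
      fourier (k : ℤ) x = ((starRingEnd ℂ) c / 2) * fourier ((j : ℤ) + k) x +
        (c / 2) * (fourier (k : ℤ) x * (starRingEnd ℂ) (fourier (j : ℤ) x)) := by
    intro x
    rw [Complex.re_eq_add_conj, fourier_add, map_mul, Complex.conj_conj]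
    ring
  simp only [he]
  rw [integral_add (integrable_of_continuous _ (by fun_prop))
    (integrable_of_continuous _ (by fun_prop)), integral_const_mul, integral_const_mul,
    integral_fourier, integral_fourier_mul_conj, if_neg (by omega)]
  simp only [Nat.cast_inj, mul_zero, zero_add, mul_ite, mul_one, eq_comm]

lemma IsCosineSeries.integral_field_mul_fourier (hw : IsCosineSeries W w W₀) {a : ℕ → ℂ}
    (ha : a ∈ polydisc) {k : ℕ} (hk : k ≠ 0) :
    ∫ x, (field w a x : ℂ) * fourier (k : ℤ) x = w k * a k := by
  have h := hasSum_integral_of_bound (μ := (volume : Measure UnitAddCircle))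
    (φ := fun j x => ((2 * w j * ((starRingEnd ℂ) (a j) * fourier (j : ℤ) x).re : ℝ) : ℂ) *
      fourier (k : ℤ) x)
    (F := fun x => (field w a x : ℂ) * fourier (k : ℤ) x)
    (u := fun j => 2 * w j) (fun j => by fun_prop)
    (fun j x => by
      rw [norm_mul, norm_fourier_apply, mul_one, Complex.norm_real]
      exact abs_field_term_le hw ha j x)
    (hw.summable.mul_left 2)
    (fun x => (Complex.hasSum_ofReal.2 (hw.hasSum_field ha x)).mul_right _)
  refine h.unique ?_
  convert! hasSum_ite_eq k ((w k : ℂ) * a k) using 2 with j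
  have := integral_re_mul_fourier (a j) (j := j) hk
  push_cast
  simp only [mul_assoc] at this ⊢
  rw [integral_const_mul, integral_const_mul, this]
  split_ifs with hjk
  · rw [hjk]; ring
  · simp

lemma IsCosineSeries.hasSum_integral_field_sq (hw : IsCosineSeries W w W₀) {a : ℕ → ℂ}
    (ha : a ∈ polydisc) :
    HasSum (fun k => 2 * w k ^ 2 * ‖a k‖ ^ 2) (∫ x, field w a x ^ 2) := by
  have h := hasSum_integral_of_bound (μ := (volume : Measure UnitAddCircle))
    (φ := fun k x => 2 * w k * ((starRingEnd ℂ) (a k) * fourier (k : ℤ) x).re * field w a x)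
    (F := fun x => field w a x * field w a x)
    (u := fun k => 2 * w k * ‖field w a‖) (fun k => by fun_prop)
    (fun k x => by
      rw [norm_mul]
      exact mul_le_mul (abs_field_term_le hw ha k x) ((field w a).norm_coe_le_norm x)
        (norm_nonneg _) (by linarith [hw.nonneg k]))
    ((hw.summable.mul_left 2).mul_right _) (fun x => (hw.hasSum_field ha x).mul_right _)
  simp only [← sq] at h
  convert! h using 2 with k
  rcases eq_or_ne k 0 with rfl | hk
  · simp [hw.zero]
  · have h1 := integral_re (integrable_of_continuous (volume : Measure UnitAddCircle)
      (f := fun x => (starRingEnd ℂ) (a k) * ((field w a x : ℂ) * fourier (k : ℤ) x))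
      (by fun_prop))
    rw [integral_const_mul, hw.integral_field_mul_fourier ha hk] at h1
    have h2 : ∀ x, 2 * w k * ((starRingEnd ℂ) (a k) * fourier (k : ℤ) x).re * field w a x =
        2 * w k * RCLike.re ((starRingEnd ℂ) (a k) * ((field w a x : ℂ) * fourier (k : ℤ) x)) := by
      intro x
      rw [mul_left_comm, RCLike.re_eq_complex_re, Complex.re_ofReal_mul]
      ring
    simp only [h2]
    rw [integral_const_mul, h1, mul_left_comm, RCLike.re_eq_complex_re, Complex.re_ofReal_mul,
      ← Complex.normSq_eq_conj_mul_self, Complex.ofReal_re, Complex.normSq_eq_norm_sq]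
    ring

lemma exp_le_of_abs_le {y M : ℝ} (hy : |y| ≤ M) (hM : M ≤ 1) :
    Real.exp y ≤ 1 + y + (1 + M) / 2 * y ^ 2 := by
  have h := (abs_le.1 (Real.exp_bound (hy.trans hM) (n := 3) (by norm_num))).2
  simp only [Finset.sum_range_succ, Finset.sum_range_zero] at h
  norm_num [Nat.factorial] at h
  have h1 : |y| ^ 3 ≤ M * y ^ 2 := by
    calc |y| ^ 3 = |y| * y ^ 2 := by rw [← sq_abs y]; ring
      _ ≤ M * y ^ 2 := by gcongr
  nlinarith [abs_nonneg y]

/-- Local stability: if the potential `2 K field a` is small, then a nonpositive value of the dual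
functional forces `a` to vanish. -/
lemma IsCosineSeries.energy_eq_zero_of_dual_nonpos (hw : IsCosineSeries W w W₀) {K M : ℝ}
    (hK : 0 < K) {a : ℕ → ℂ} (ha : a ∈ polydisc) (hle : ∀ k, k ≠ 0 → w k ≤ w 1)
    (hM : ‖(2 * K) • field w a‖ ≤ M) (hM1 : M ≤ 1) (hstab : 2 * K * w 1 * (1 + M) < 1)
    (hdual : dual w K a ≤ 0) : energy w a = 0 := by
  have hM0 : 0 ≤ M := (norm_nonneg _).trans hM
  set f := (2 * K) • field w a with hf
  have h1 : ∫ x, Real.exp (f x) ≤ ∫ x, (1 + f x + (1 + M) / 2 * f x ^ 2) :=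
    integral_mono (integrable_of_continuous _ (by fun_prop))
      (integrable_of_continuous _ (by fun_prop))
      fun x => exp_le_of_abs_le ((f.norm_coe_le_norm x).trans hM) hM1
  have h2 : ∫ x, (1 + f x + (1 + M) / 2 * f x ^ 2) =
      1 + (1 + M) / 2 * ((2 * K) ^ 2 * ∫ x, field w a x ^ 2) := by
    rw [integral_add (integrable_of_continuous _ (by fun_prop))
      (integrable_of_continuous _ (by fun_prop)),
      integral_add (integrable_of_continuous _ (by fun_prop))
      (integrable_of_continuous _ (by fun_prop)), integral_const_mul]
    simp only [hf, ContinuousMap.smul_apply, smul_eq_mul, mul_pow]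
    rw [integral_const_mul, integral_const_mul, hw.integral_field ha]
    simp
  have h3 : ∫ x, field w a x ^ 2 ≤ 2 * w 1 * energy w a := by
    refine hasSum_le (fun k => ?_) (hw.hasSum_integral_field_sq ha)
      ((hw.summable_energy ha).hasSum.mul_left (2 * w 1))
    rcases eq_or_ne k 0 with rfl | hk
    · simp [hw.zero]
    · have h4 := hw.nonneg k
      have h5 := mul_le_mul_of_nonneg_right (hle k hk) (mul_nonneg h4 (sq_nonneg ‖a k‖))
      linarith
  have h4 := Real.log_le_sub_one_of_pos (integral_exp_continuousMap_pos f)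
  rw [dual, logPartition, ← hf] at hdual
  have h5 : 2 * K * energy w a ≤
      (1 + M) / 2 * ((2 * K) ^ 2 * (2 * w 1 * energy w a)) := by
    have : (1 + M) / 2 * ((2 * K) ^ 2 * ∫ x, field w a x ^ 2) ≤
        (1 + M) / 2 * ((2 * K) ^ 2 * (2 * w 1 * energy w a)) := by gcongr
    linarith
  have h6 : 2 * K * energy w a * (1 - 2 * K * w 1 * (1 + M)) ≤ 0 := by linarith
  have h7 : 2 * K * energy w a ≤ 0 := by
    by_contra h
    exact absurd (mul_pos (not_le.1 h) (by linarith : 0 < 1 - 2 * K * w 1 * (1 + M)))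
      (not_lt.2 h6)
  have h8 := hw.energy_nonneg a
  nlinarith

lemma IsCosineSeries.norm_field_le (hw : IsCosineSeries W w W₀) {a : ℕ → ℂ}
    {l : ℝ} (hal : ∀ k, k ≠ 0 → ‖a k‖ ≤ l) :
    ‖field w a‖ ≤ 2 * (∑' k, w k) * l := by
  have hsum := (hw.summable.hasSum.mul_left 2).mul_right l
  refine tsum_of_norm_bounded hsum fun k => ?_
  have h0 := hw.nonneg k
  rw [norm_smul, Real.norm_of_nonneg (by linarith)]
  rcases eq_or_ne k 0 with rfl | hk
  · simp [hw.zero]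
  · exact mul_le_mul_of_nonneg_left ((norm_harmonic_le _ _).trans (hal k hk)) (by linarith)

/-- If the critical coupling lies strictly below the linear stability threshold, the transition is
discontinuous: minimizers close to the uniform distribution coincide with it. -/
lemma IsCosineSeries.not_isContinuousTransition (hw : IsCosineSeries W w W₀) {Kc : ℝ}
    (hKc : IsCriticalCoupling W Kc) (hle : ∀ k, k ≠ 0 → w k ≤ w 1) (hlt : 2 * Kc * w 1 < 1) :
    ¬ IsContinuousTransition W Kc := by
  rintro ⟨-, hcont⟩
  have hex : ∀ K : ℝ, ∃ q, Kc < K → q ≠ uniform ∧ IsGlobalMinimizer W K q := by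
    intro K
    by_cases hK : Kc < K
    · obtain ⟨q, hq⟩ := hKc.supercritical K hK
      exact ⟨q, fun _ => hq⟩
    · exact ⟨uniform, fun h => absurd h hK⟩
  choose q hq using hex
  have hlim := hcont q fun K hK => (hq K hK).2
  have ht : Tendsto (fun K => l1DistUniform (q K)) (𝓝[>] Kc) (𝓝 0) :=
    tendsto_of_le_liminf_of_limsup_le bot_le hlim.le
  have htr : Tendsto (fun K => (l1DistUniform (q K)).toReal) (𝓝[>] Kc) (𝓝 0) := by
    simpa [Function.comp_def] using (ENNReal.tendsto_toReal ENNReal.zero_ne_top).comp ht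
  have hid : Tendsto (fun K : ℝ => K) (𝓝[>] Kc) (𝓝 Kc) := nhdsWithin_le_nhds
  set S := ∑' k, w k with hS
  have hM : Tendsto (fun K => 2 * K * (2 * S * (l1DistUniform (q K)).toReal)) (𝓝[>] Kc)
      (𝓝 0) := by
    simpa using (hid.const_mul 2).mul (htr.const_mul (2 * S))
  have hst : Tendsto
      (fun K => 2 * K * w 1 * (1 + 2 * K * (2 * S * (l1DistUniform (q K)).toReal)))
      (𝓝[>] Kc) (𝓝 (2 * Kc * w 1)) := by
    simpa using ((hid.const_mul 2).mul_const (w 1)).mul (hM.const_add 1)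
  obtain ⟨K, hK1, hK2, hK3, hK4⟩ := ((hM.eventually_lt_const one_pos).and
    ((hst.eventually_lt_const hlt).and ((ht.eventually_lt_const ENNReal.zero_lt_top).and
      self_mem_nhdsWithin))).exists
  have hK0 : 0 < K := hKc.pos.trans hK4
  obtain ⟨hne, hmin⟩ := hq K hK4
  have hfin := (hw.isGlobalMinimizer_iff.1 hmin).1
  have hE := hw.entropy_le_of_isGlobalMinimizer hmin
  have hl : ∀ k, k ≠ 0 → ‖modeOf (q K) k‖ ≤ (l1DistUniform (q K)).toReal := by
    intro k hk
    have := ENNReal.toReal_mono hK3.ne (enorm_modeOf_le hfin hk)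
    rwa [toReal_enorm] at this
  have hen : energy w (modeOf (q K)) = 0 := by
    refine hw.energy_eq_zero_of_dual_nonpos hK0 (modeOf_mem_polydisc _) hle ?_ hK1.le hK2 ?_
    · rw [norm_smul, Real.norm_of_nonneg (by linarith)]
      gcongr
      exact hw.norm_field_le hl
    · have h1 := hw.dual_le_excess K hfin
      rw [excess] at h1
      linarith
  refine hne (entropy_eq_zero_of_toReal_nonpos hfin ?_)
  rw [hen] at hE
  linarith

end

/-! ### The Hegselmann–Krause potential -/

/-- The cosine coefficients `2 (kR - sin kR) / (π k³)` of the Hegselmann–Krause potential. Division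
by zero makes the value at `k = 0` vanish. -/
noncomputable def hkCoeff (R : ℝ) (k : ℤ) : ℝ :=
  2 / Real.pi * ((k * R - Real.sin (k * R)) / (k : ℝ) ^ 3)

lemma hkKernel_coe_of_abs_le (R : ℝ) {θ : ℝ} (hθ : |θ| ≤ 1 / 2) :
    hkKernel R (θ : UnitAddCircle) = (max (R - 2 * Real.pi * |θ|) 0) ^ 2 := by
  have h : ‖(θ : UnitAddCircle)‖ = |θ| :=
    (AddCircle.norm_coe_eq_abs_iff (p := 1) (x := θ) one_ne_zero).2 (by rwa [abs_one])
  simp only [hkKernel, ContinuousMap.coe_mk, h]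

/-- Since the potential is even, its Fourier coefficients are real cosine integrals. -/
lemma fourierCoeff_hkKernel_eq_integral (R : ℝ) (n : ℤ) :
    fourierCoeff (fun x : UnitAddCircle => (hkKernel R x : ℂ)) n =
      ((∫ x in (0 : ℝ)..(1 / 2), 2 * Real.cos (2 * Real.pi * n * x) *
        (max (R - 2 * Real.pi * x) 0) ^ 2 : ℝ) : ℂ) := by
  set g : ℝ → ℂ := fun x => fourier (-n) (x : UnitAddCircle) • (hkKernel R (x : UnitAddCircle) : ℂ)
    with hg
  have hgc : Continuous g := by
    have : Continuous fun x : UnitAddCircle => fourier (-n) x • (hkKernel R x : ℂ) := by fun_prop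
    exact this.comp (AddCircle.continuous_mk' 1)
  have hgi : ∀ a b : ℝ, IntervalIntegrable g volume a b := fun a b => hgc.intervalIntegrable a b
  rw [fourierCoeff_eq_intervalIntegral _ n (-(1 / 2))]
  have e1 : (-(1 / 2) + 1 : ℝ) = 1 / 2 := by norm_num
  rw [e1, div_one, one_smul]
  change ∫ x in (-(1 / 2) : ℝ)..(1 / 2), g x = _
  rw [← intervalIntegral.integral_add_adjacent_intervals (hgi _ 0) (hgi 0 _)]
  have e2 : ∫ x in (-(1 / 2) : ℝ)..0, g x = ∫ x in (0 : ℝ)..(1 / 2), g (-x) := by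
    rw [intervalIntegral.integral_comp_neg]; simp
  rw [e2, ← intervalIntegral.integral_add
    (Continuous.intervalIntegrable (u := fun x => g (-x)) (hgc.comp continuous_neg) _ _) (hgi _ _),
    ← intervalIntegral.integral_ofReal]
  refine intervalIntegral.integral_congr fun x hx => ?_
  rw [Set.uIcc_of_le (by norm_num)] at hx
  have hx0 : |x| = x := abs_of_nonneg hx.1
  have h1 : hkKernel R ((-x : ℝ) : UnitAddCircle) = (max (R - 2 * Real.pi * x) 0) ^ 2 := by
    rw [hkKernel_coe_of_abs_le R (by rw [abs_neg, hx0]; exact hx.2), abs_neg, hx0]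
  have h2 : hkKernel R (x : UnitAddCircle) = (max (R - 2 * Real.pi * x) 0) ^ 2 := by
    rw [hkKernel_coe_of_abs_le R (by rw [hx0]; exact hx.2), hx0]
  simp only [hg, smul_eq_mul, h1, h2, fourier_coe_apply]
  rw [← add_mul]
  push_cast
  congr 1
  rw [Complex.cos, mul_div_cancel₀ _ (two_ne_zero)]
  congr 2 <;> ring

lemma integral_cos_mul_sq {R : ℝ} (hR : 0 ≤ R) (hRpi : R ≤ Real.pi) {n : ℤ} (hn : n ≠ 0) :
    ∫ x in (0 : ℝ)..(1 / 2), 2 * Real.cos (2 * Real.pi * n * x) *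
        (max (R - 2 * Real.pi * x) 0) ^ 2 = hkCoeff R n := by
  have hpi := Real.pi_pos
  have hn' : (n : ℝ) ≠ 0 := Int.cast_ne_zero.2 hn
  set b := R / (2 * Real.pi) with hb
  have hb2 : 2 * Real.pi * b = R := by rw [hb]; field_simp
  have hb0 : 0 ≤ b := by positivity
  have hbh : b ≤ 1 / 2 := by rw [hb, div_le_iff₀ (by positivity)]; linarith
  set F : ℝ → ℝ := fun x => 2 * Real.cos (2 * Real.pi * n * x) *
    (max (R - 2 * Real.pi * x) 0) ^ 2 with hF
  have hFc : Continuous F := by fun_prop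
  rw [← intervalIntegral.integral_add_adjacent_intervals (hFc.intervalIntegrable 0 b)
    (hFc.intervalIntegrable b _)]
  have h2 : ∫ x in b..(1 / 2), F x = 0 := by
    rw [intervalIntegral.integral_congr (g := fun _ => 0)]
    · simp
    · intro x hx
      rw [Set.uIcc_of_le hbh] at hx
      have : R - 2 * Real.pi * x ≤ 0 := by
        have := mul_le_mul_of_nonneg_left hx.1 (by positivity : 0 ≤ 2 * Real.pi)
        linarith
      simp [hF, max_eq_right this]
  have h1 : ∫ x in (0 : ℝ)..b, F x =
      ∫ x in (0 : ℝ)..b, 2 * Real.cos (2 * Real.pi * n * x) * (R - 2 * Real.pi * x) ^ 2 := by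
    refine intervalIntegral.integral_congr fun x hx => ?_
    rw [Set.uIcc_of_le hb0] at hx
    have : 0 ≤ R - 2 * Real.pi * x := by
      have := mul_le_mul_of_nonneg_left hx.2 (by positivity : 0 ≤ 2 * Real.pi)
      linarith
    simp [hF, max_eq_left this]
  set m := 2 * Real.pi * n with hm
  have hm0 : m ≠ 0 := by rw [hm]; positivity
  -- integrate by parts twice
  have h3 : ∀ x ∈ Set.uIcc 0 b, HasDerivAt (fun x => 2 * ((R - 2 * Real.pi * x) ^ 2 *
      Real.sin (m * x) / m - 4 * Real.pi * (R - 2 * Real.pi * x) * Real.cos (m * x) / m ^ 2 -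
      8 * Real.pi ^ 2 * Real.sin (m * x) / m ^ 3))
      (2 * Real.cos (m * x) * (R - 2 * Real.pi * x) ^ 2) x := by
    intro x _
    have hmx : HasDerivAt (fun x => m * x) m x := by simpa using (hasDerivAt_id x).const_mul m
    have hu : HasDerivAt (fun x => R - 2 * Real.pi * x) (-(2 * Real.pi)) x := by
      simpa using ((hasDerivAt_id x).const_mul (2 * Real.pi)).const_sub R
    have := (((((hu.pow 2).mul hmx.sin).div_const m).sub
      (((hu.const_mul (4 * Real.pi)).mul hmx.cos).div_const (m ^ 2))).sub
      ((hmx.sin.const_mul (8 * Real.pi ^ 2)).div_const (m ^ 3))).const_mul 2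
    refine this.congr_deriv ?_
    simp only [Pi.pow_apply]
    field_simp
    push_cast
    ring
  rw [h2, add_zero, h1, intervalIntegral.integral_eq_sub_of_hasDerivAt h3
    (Continuous.intervalIntegrable (by fun_prop) _ _), hkCoeff]
  have hmb : m * b = n * R := by rw [hm, ← hb2]; ring
  rw [hmb, hb2]
  simp only [mul_zero, Real.sin_zero, Real.cos_zero, sub_self, hm]
  field_simp
  ring

lemma fourierCoeff_hkKernel {R : ℝ} (hR : 0 ≤ R) (hRpi : R ≤ Real.pi) {n : ℤ} (hn : n ≠ 0) :
    fourierCoeff (fun x : UnitAddCircle => (hkKernel R x : ℂ)) n = (hkCoeff R n : ℂ) := by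
  rw [fourierCoeff_hkKernel_eq_integral, integral_cos_mul_sq hR hRpi hn]

lemma fourierHat_hkKernel {R : ℝ} (hR : 0 ≤ R) (hRpi : R ≤ Real.pi) {k : ℕ} (hk : k ≠ 0) :
    fourierHat (hkKernel R) k = hkCoeff R k := by
  rw [fourierHat, fourierCoeff_hkKernel hR hRpi (by exact_mod_cast hk), Complex.ofReal_re]

lemma hkCoeff_neg (R : ℝ) (n : ℤ) : hkCoeff R (-n) = hkCoeff R n := by
  rw [hkCoeff, hkCoeff]
  push_cast
  rw [neg_mul, Real.sin_neg, Odd.neg_pow (by decide), div_neg, ← neg_div]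
  congr 2
  ring

lemma abs_hkCoeff_le {R : ℝ} (hR : 0 ≤ R) (n : ℤ) :
    |hkCoeff R n| ≤ 4 * R / Real.pi * (1 / (n : ℝ) ^ 2) := by
  have hpi := Real.pi_pos
  rcases eq_or_ne n 0 with rfl | hn
  · simp [hkCoeff]
  have hn' : 0 < |(n : ℝ)| := abs_pos.2 (Int.cast_ne_zero.2 hn)
  have h1 : |(n : ℝ) * R - Real.sin (n * R)| ≤ 2 * (|(n : ℝ)| * R) := by
    refine (abs_sub _ _).trans ?_
    have := Real.abs_sin_le_abs (x := n * R)
    rw [abs_mul, abs_of_nonneg hR] at this ⊢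
    linarith
  rw [hkCoeff, abs_mul, abs_div, abs_div, abs_pow, abs_of_pos hpi, abs_two, ← sq_abs (n : ℝ)]
  calc 2 / Real.pi * (|(n : ℝ) * R - Real.sin (n * R)| / |(n : ℝ)| ^ 3)
      ≤ 2 / Real.pi * (2 * (|(n : ℝ)| * R) / |(n : ℝ)| ^ 3) := by gcongr
    _ = _ := by field_simp; ring

lemma hkCoeff_pos {R : ℝ} (hR : 0 < R) {k : ℕ} (hk : k ≠ 0) : 0 < hkCoeff R k := by
  have hk' : (0 : ℝ) < k := by exact_mod_cast Nat.pos_of_ne_zero hk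
  have := Real.sin_lt (mul_pos hk' hR)
  have hpi := Real.pi_pos
  rw [hkCoeff]
  push_cast
  exact mul_pos (by positivity) (div_pos (by linarith) (by positivity))

lemma isCosineSeries_hkKernel {R : ℝ} (hR : 0 < R) (hRpi : R ≤ Real.pi) :
    ∃ W₀, IsCosineSeries (hkKernel R) (fun k : ℕ => hkCoeff R k) W₀ := by
  have hsq : Summable fun n : ℤ => 4 * R / Real.pi * (1 / (n : ℝ) ^ 2) :=
    (Real.summable_one_div_int_pow.2 one_lt_two).mul_left _
  have hcoeff : Summable fun n : ℤ => hkCoeff R n :=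
    Summable.of_norm_bounded hsq (abs_hkCoeff_le hR.le)
  set W₀ : ℝ := ∫ x in (0 : ℝ)..(1 / 2), 2 * Real.cos (2 * Real.pi * (0 : ℤ) * x) *
        (max (R - 2 * Real.pi * x) 0) ^ 2 with hW₀
  have h0 : hkCoeff R 0 = 0 := by simp [hkCoeff]
  set f : C(UnitAddCircle, ℂ) := ⟨fun x => (hkKernel R x : ℂ), by fun_prop⟩ with hf
  have hfc : ∀ n : ℤ, fourierCoeff f n = (hkCoeff R n : ℂ) + if n = 0 then (W₀ : ℂ) else 0 := by
    intro n
    split_ifs with hn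
    · rw [hn, h0, Complex.ofReal_zero, zero_add]
      exact fourierCoeff_hkKernel_eq_integral R 0
    · rw [add_zero]
      exact fourierCoeff_hkKernel hR.le hRpi hn
  have hsum : Summable (fourierCoeff f) := by
    have h1 : Summable fun n : ℤ => (hkCoeff R n : ℂ) := Complex.summable_ofReal.2 hcoeff
    exact (h1.add (hasSum_ite_eq (0 : ℤ) (W₀ : ℂ)).summable).congr fun n => (hfc n).symm
  refine ⟨W₀, by simpa using h0, fun k hk => hkCoeff_pos hR hk, ?_, fun x => ?_⟩
  · exact hcoeff.comp_injective Nat.cast_injective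
  · have h1 := (has_pointwise_sum_fourier_series_of_summable hsum x).nat_add_neg
    have h2 := h1.sub (hasSum_ite_eq (0 : ℕ) (2 * W₀ : ℂ))
    have h3 := Complex.hasSum_re h2
    convert! h3 using 1
    · funext k
      rcases eq_or_ne k 0 with rfl | hk
      · simp [hfc, h0, two_mul]
      · have hk' : (k : ℤ) ≠ 0 := by exact_mod_cast hk
        simp only [hfc, hkCoeff_neg, neg_eq_zero, if_neg hk', if_neg hk, add_zero, sub_zero,
          smul_eq_mul, fourier_neg]
        rw [← mul_add, Complex.add_conj, ← Complex.ofReal_mul, Complex.ofReal_re]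
        ring
    · rw [hfc 0, h0]
      simp [hf, two_mul]

lemma abs_sin_natCast_mul_le (k : ℕ) (x : ℝ) : |Real.sin (k * x)| ≤ k * |Real.sin x| := by
  induction k with
  | zero => simp
  | succ k ih =>
    push_cast
    rw [add_mul, one_mul, Real.sin_add]
    refine (abs_add_le _ _).trans ?_
    rw [abs_mul, abs_mul]
    have h1 := mul_le_mul ih (Real.abs_cos_le_one x) (abs_nonneg _) (by positivity)
    have h2 := mul_le_mul_of_nonneg_right (Real.abs_cos_le_one (k * x)) (abs_nonneg (Real.sin x))
    linarith

/-- `k R - sin kR ≤ k³ (R - sin R)`, by comparing derivatives in `R`. -/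
lemma mul_sub_sin_le (k : ℕ) {R : ℝ} (hR : 0 ≤ R) :
    k * R - Real.sin (k * R) ≤ (k : ℝ) ^ 3 * (R - Real.sin R) := by
  set G : ℝ → ℝ := fun x => (k : ℝ) ^ 3 * (x - Real.sin x) - (k * x - Real.sin (k * x)) with hG
  have hd : ∀ x, HasDerivAt G
      ((k : ℝ) ^ 3 * (1 - Real.cos x) - (k - Real.cos (k * x) * k)) x := by
    intro x
    have hkx : HasDerivAt (fun x : ℝ => (k : ℝ) * x) k x := by
      simpa using (hasDerivAt_id x).const_mul (k : ℝ)
    exact (((hasDerivAt_id x).sub (Real.hasDerivAt_sin x)).const_mul _).sub (hkx.sub hkx.sin)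
  have hmono : Monotone G := by
    refine monotone_of_hasDerivAt_nonneg hd fun x => ?_
    have e1 : ∀ y : ℝ, 1 - Real.cos y = 2 * Real.sin (y / 2) ^ 2 := by
      intro y
      have := Real.cos_sq_add_sin_sq (y / 2)
      have h2 := Real.cos_two_mul (y / 2)
      rw [mul_div_cancel₀ y two_ne_zero] at h2
      linarith
    have h1 := abs_sin_natCast_mul_le k (x / 2)
    have h2 : Real.sin (k * x / 2) ^ 2 ≤ (k : ℝ) ^ 2 * Real.sin (x / 2) ^ 2 := by
      rw [← sq_abs, ← sq_abs (Real.sin (x / 2)), ← mul_pow, mul_div_assoc]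
      exact pow_le_pow_left₀ (abs_nonneg _) h1 2
    have h3 := e1 x
    have h4 := e1 (k * x)
    have h5 := mul_le_mul_of_nonneg_left h2 (by positivity : (0 : ℝ) ≤ 2 * k)
    have h6 : (0 : ℝ) ≤ (k : ℝ) ^ 3 * (1 - Real.cos x) - k * (1 - Real.cos (k * x)) := by
      rw [h3, h4]; linarith
    simp only [Pi.zero_apply]
    linarith
  have := hmono hR
  simp only [hG, mul_zero, Real.sin_zero, sub_self] at this
  linarith

lemma hkCoeff_le_one {R : ℝ} (hR : 0 ≤ R) {k : ℕ} (hk : k ≠ 0) : hkCoeff R k ≤ hkCoeff R 1 := by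
  have hk' : (0 : ℝ) < k := by exact_mod_cast Nat.pos_of_ne_zero hk
  have hpi := Real.pi_pos
  rw [hkCoeff, hkCoeff]
  push_cast
  refine mul_le_mul_of_nonneg_left ?_ (by positivity)
  rw [div_le_iff₀ (by positivity), one_mul, one_pow, div_one, mul_comm _ ((k : ℝ) ^ 3)]
  exact mul_sub_sin_le k hR

/-- The second mode has exactly half the strength of the first one where
`R = sin R (2 - cos R)`. -/
lemma half_lt_hkCoeff_two_iff (R : ℝ) :
    hkCoeff R 1 / 2 < hkCoeff R 2 ↔ R < Real.sin R * (2 - Real.cos R) := by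
  have hpi : 0 < 2 / Real.pi := div_pos two_pos Real.pi_pos
  rw [hkCoeff, hkCoeff, mul_div_assoc, mul_lt_mul_iff_of_pos_left hpi]
  push_cast
  rw [one_mul, Real.sin_two_mul]
  constructor <;> intro h <;> linarith

lemma hkCoeff_lt_div {R : ℝ} (hR : 7 / 4 ≤ R) {k : ℕ} (hk : 3 ≤ k) :
    hkCoeff R k < hkCoeff R 1 / k := by
  have hk' : (3 : ℝ) ≤ k := by exact_mod_cast hk
  have hpi : 0 < 2 / Real.pi := div_pos two_pos Real.pi_pos
  rw [hkCoeff, hkCoeff, mul_div_assoc, mul_lt_mul_iff_of_pos_left hpi]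
  push_cast
  rw [one_mul, one_pow, div_one, div_lt_div_iff₀ (by positivity) (by positivity)]
  have h1 := Real.sin_le_one R
  have h2 := Real.neg_one_le_sin (k * R)
  have h3 : k * R - Real.sin (k * R) < (k : ℝ) ^ 2 * (R - Real.sin R) := by
    have h4 : (k : ℝ) ^ 2 * Real.sin R ≤ (k : ℝ) ^ 2 := mul_le_of_le_one_right (by positivity) h1
    have h5 : (7 / 4 : ℝ) * (k ^ 2 - k) ≤ R * (k ^ 2 - k) :=
      mul_le_mul_of_nonneg_right hR (by nlinarith)
    nlinarith
  calc (k * R - Real.sin (k * R)) * k < (k : ℝ) ^ 2 * (R - Real.sin R) * k :=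
        mul_lt_mul_of_pos_right h3 (by positivity)
    _ = _ := by ring

lemma isLinearStabilityThreshold_hkKernel {R : ℝ} (hR : 0 < R) (hRpi : R ≤ Real.pi) :
    IsLinearStabilityThreshold (hkKernel R) (1 / (2 * hkCoeff R 1)) := by
  have h1 := fourierHat_hkKernel hR.le hRpi one_ne_zero
  have h2 := hkCoeff_pos hR one_ne_zero
  push_cast at h1 h2
  refine ⟨hkCoeff R 1, ⟨⟨1, ⟨le_rfl, by rwa [h1]⟩, h1⟩, ?_⟩, rfl⟩
  rintro _ ⟨k, ⟨hk, -⟩, rfl⟩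
  have hk0 : k ≠ 0 := by omega
  rw [fourierHat_hkKernel hR.le hRpi hk0]
  exact hkCoeff_le_one hR.le hk0

/-- The sign of `R - sin R (2 - cos R)`, whose derivative is `2 cos R (cos R - 1)`: it decreases
on `[0, π / 2]` and increases on `[π / 2, π]`. -/
lemma exists_root : ∃ Rs : ℝ, 7 / 4 < Rs ∧ Rs < Real.pi ∧
    Rs = Real.sin Rs * (2 - Real.cos Rs) ∧
    (∀ R, 0 < R → R < Rs → R < Real.sin R * (2 - Real.cos R)) ∧
    ∀ R, Rs < R → R ≤ Real.pi → Real.sin R * (2 - Real.cos R) < R := by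
  set g : ℝ → ℝ := fun x => x - Real.sin x * (2 - Real.cos x) with hg
  have hgc : Continuous g := by fun_prop
  have hd : ∀ x, deriv g x = 2 * Real.cos x * (Real.cos x - 1) := by
    intro x
    have := ((hasDerivAt_id x).sub ((Real.hasDerivAt_sin x).mul
      ((Real.hasDerivAt_cos x).const_sub 2))).deriv
    refine this.trans ?_
    have := Real.cos_sq_add_sin_sq x
    linear_combination -this
  have hcos1 : ∀ x, 0 < x → x < Real.pi → Real.cos x < 1 := by
    intro x h0 h1
    rw [← Real.cos_zero]
    exact Real.cos_lt_cos_of_nonneg_of_le_pi le_rfl h1.le h0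
  have hpi := Real.pi_gt_d2
  have hpi' := Real.pi_lt_d2
  have hanti : StrictAntiOn g (Set.Icc 0 (Real.pi / 2)) := by
    refine strictAntiOn_of_deriv_neg (convex_Icc _ _) hgc.continuousOn fun x hx => ?_
    rw [interior_Icc] at hx
    rw [hd]
    have h1 := Real.cos_pos_of_mem_Ioo ⟨by linarith [hx.1], hx.2⟩
    have h2 := hcos1 x hx.1 (by linarith [hx.2])
    exact mul_neg_of_pos_of_neg (by linarith) (by linarith)
  have hmono : StrictMonoOn g (Set.Icc (Real.pi / 2) Real.pi) := by
    refine strictMonoOn_of_deriv_pos (convex_Icc _ _) hgc.continuousOn fun x hx => ?_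
    rw [interior_Icc] at hx
    rw [hd]
    have h1 := Real.cos_neg_of_pi_div_two_lt_of_lt hx.1 (by linarith [hx.2])
    exact mul_pos_of_neg_of_neg (by linarith) (by linarith)
  have hg0 : g 0 = 0 := by simp [hg]
  have hgpi : 0 < g Real.pi := by simp [hg, Real.pi_pos]
  have hg74 : g (7 / 4) < 0 := by
    have h1 : Real.cos (7 / 4) < 0 :=
      Real.cos_neg_of_pi_div_two_lt_of_lt (by linarith) (by linarith)
    have h2 : 49 / 50 ≤ Real.sin (7 / 4) := by
      have h3 := Real.one_sub_sq_div_two_le_cos (x := 7 / 4 - Real.pi / 2)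
      rw [Real.cos_sub_pi_div_two] at h3
      nlinarith
    simp only [hg]
    nlinarith
  obtain ⟨Rs, hRs, hroot⟩ := intermediate_value_Icc (by linarith : (7 / 4 : ℝ) ≤ Real.pi)
    hgc.continuousOn (⟨hg74.le, hgpi.le⟩ : (0 : ℝ) ∈ Set.Icc (g (7 / 4)) (g Real.pi))
  have hRs1 : 7 / 4 < Rs := lt_of_le_of_ne hRs.1 fun h => by rw [h, hroot] at hg74; linarith
  have hRs2 : Rs < Real.pi := lt_of_le_of_ne hRs.2 fun h => by rw [← h, hroot] at hgpi; linarith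
  refine ⟨Rs, hRs1, hRs2, by simp only [hg] at hroot; linarith, fun R h0 hlt => ?_,
    fun R hlt hle => ?_⟩
  · have : g R < 0 := by
      rcases le_total R (Real.pi / 2) with h | h
      · rw [← hg0]
        exact hanti ⟨le_rfl, by linarith⟩ ⟨h0.le, h⟩ h0
      · rw [← hroot]
        exact hmono ⟨h, by linarith⟩ ⟨by linarith, hRs2.le⟩ hlt
    simp only [hg] at this
    linarith
  · have : 0 < g R := by
      rw [← hroot]
      exact hmono ⟨by linarith, hRs2.le⟩ ⟨by linarith, hle⟩ hlt
    simp only [hg] at this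
    linarith

lemma exists_isCriticalCoupling_hkKernel {R : ℝ} (hR : 0 < R) (hRpi : R ≤ Real.pi) :
    ∃ Kc, IsCriticalCoupling (hkKernel R) Kc := by
  obtain ⟨W₀, hw⟩ := isCosineSeries_hkKernel hR hRpi
  have hpi := Real.pi_pos
  have h1 : 0 < hkCoeff R 1 := hkCoeff_pos hR one_ne_zero
  have hmin : IsGlobalMinimizer (hkKernel R) (Real.pi / (8 * R)) uniform := by
    refine hw.isGlobalMinimizer_uniform_of_le (by positivity) fun k => ?_
    rcases Nat.eq_zero_or_pos k with rfl | hk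
    · simp [hkCoeff]
    · have hk' : (1 : ℝ) ≤ k := by exact_mod_cast hk
      have h2 := (le_abs_self _).trans (abs_hkCoeff_le hR.le k)
      calc 2 * (Real.pi / (8 * R)) * hkCoeff R k
          ≤ 2 * (Real.pi / (8 * R)) * (4 * R / Real.pi * (1 / ((k : ℤ) : ℝ) ^ 2)) := by gcongr
        _ = 1 / (k : ℝ) ^ 2 := by push_cast; field_simp; norm_num
        _ ≤ 1 / k := by
          refine one_div_le_one_div_of_le (by positivity) ?_
          nlinarith
  have hnot : ¬ IsGlobalMinimizer (hkKernel R) (1 / hkCoeff R 1) uniform := by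
    refine hw.not_isGlobalMinimizer_of_one_lt (by positivity) ?_
    push_cast
    rw [mul_assoc, one_div_mul_cancel h1.ne']
    norm_num
  obtain ⟨Kc, hKc, -⟩ := hw.exists_isCriticalCoupling (by positivity) hmin hnot
  exact ⟨Kc, hKc⟩

/-- The case where the second mode has more than half the strength of the first one. -/
lemma hkKernel_discontinuous {R : ℝ} (hR : 0 < R) (hRpi : R ≤ Real.pi)
    (h : R < Real.sin R * (2 - Real.cos R)) {Kc : ℝ} (hKc : IsCriticalCoupling (hkKernel R) Kc) :
    Kc < 1 / (2 * hkCoeff R 1) ∧ ¬ IsContinuousTransition (hkKernel R) Kc := by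
  obtain ⟨W₀, hw⟩ := isCosineSeries_hkKernel hR hRpi
  have h1 : 0 < hkCoeff R 1 := hkCoeff_pos hR one_ne_zero
  have e1 : 2 * (1 / (2 * hkCoeff R 1)) * hkCoeff R 1 = 1 := by field_simp
  have hnot : ¬ IsGlobalMinimizer (hkKernel R) (1 / (2 * hkCoeff R 1)) uniform := by
    refine hw.not_isGlobalMinimizer_of_half_lt (by positivity) e1 ?_
    have h2 := (half_lt_hkCoeff_two_iff R).2 h
    have e2 : 2 * (1 / (2 * hkCoeff R 1)) * hkCoeff R (2 : ℕ) = hkCoeff R 2 / hkCoeff R 1 := by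
      push_cast; field_simp
    rw [e2, lt_div_iff₀ h1]
    linarith
  have hlt : Kc < 1 / (2 * hkCoeff R 1) := by
    by_contra hle
    exact hnot (hw.isGlobalMinimizer_uniform_mono (not_lt.1 hle) hKc.critical)
  refine ⟨hlt, hw.not_isContinuousTransition hKc (fun k hk => hkCoeff_le_one hR.le hk) ?_⟩
  rw [← e1]
  have := mul_lt_mul_of_pos_right hlt h1
  push_cast
  linarith

/-- The case where the second mode has at most half the strength of the first one. -/
lemma hkKernel_continuous {R : ℝ} (hR : 7 / 4 ≤ R) (hRpi : R ≤ Real.pi)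
    (h : Real.sin R * (2 - Real.cos R) ≤ R) {Kc : ℝ} (hKc : IsCriticalCoupling (hkKernel R) Kc) :
    Kc = 1 / (2 * hkCoeff R 1) ∧ IsContinuousTransition (hkKernel R) Kc := by
  have hR0 : 0 < R := by linarith
  obtain ⟨W₀, hw⟩ := isCosineSeries_hkKernel hR0 hRpi
  have h1 : 0 < hkCoeff R 1 := hkCoeff_pos hR0 one_ne_zero
  have e : ∀ k : ℕ, 2 * (1 / (2 * hkCoeff R 1)) * hkCoeff R k = hkCoeff R k / hkCoeff R 1 := by
    intro k; field_simp
  have h3 : ∀ k : ℕ, 3 ≤ k → 2 * (1 / (2 * hkCoeff R 1)) * hkCoeff R k < 1 / k := by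
    intro k hk
    rw [e, div_lt_iff₀ h1, one_div_mul_eq_div]
    exact hkCoeff_lt_div hR hk
  have hle : ∀ k : ℕ, 2 * (1 / (2 * hkCoeff R 1)) * hkCoeff R k ≤ 1 / k := by
    intro k
    rcases lt_or_ge k 3 with hk | hk
    · rw [e]
      interval_cases k
      · simp [hkCoeff]
      · simp [div_self h1.ne']
      · rw [div_le_iff₀ h1]
        have h2 := not_lt.1 (mt (half_lt_hkCoeff_two_iff R).1 (not_lt.2 h))
        push_cast
        linarith
    · exact (h3 k hk).le
  have hmin := hw.isGlobalMinimizer_uniform_of_le (by positivity) hle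
  have heq : Kc = 1 / (2 * hkCoeff R 1) := by
    refine le_antisymm ?_ ?_
    · by_contra hlt
      refine hw.not_isGlobalMinimizer_of_one_lt hKc.pos.le ?_ hKc.critical
      have := mul_lt_mul_of_pos_right (not_le.1 hlt) h1
      have e1 : 1 / (2 * hkCoeff R 1) * hkCoeff R 1 = 1 / 2 := by field_simp
      rw [e1] at this
      push_cast
      linarith
    · by_contra hlt
      obtain ⟨q, hne, hq⟩ := hKc.supercritical _ (not_le.1 hlt)
      exact hne (hw.eq_uniform_of_le hle h3 hq)
  rw [heq]
  exact ⟨rfl, hw.isContinuousTransition (by positivity) hmin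
    fun q hq => hw.eq_uniform_of_le hle h3 hq⟩

end MeanFieldCircle

theorem theorem1p7 :
    ∃ Rs : ℝ,
      ((0 < Rs ∧ Rs < Real.pi ∧ Rs = Real.sin Rs * (2 - Real.cos Rs)) ∧
        ∀ r : ℝ, 0 < r → r < Real.pi → r = Real.sin r * (2 - Real.cos r) → r = Rs) ∧
      (∀ R : ℝ, 0 < R → R < Rs →
        ∃ Kc Ks : ℝ,
          MeanFieldCircle.IsCriticalCoupling (MeanFieldCircle.hkKernel R) Kc ∧
          MeanFieldCircle.IsLinearStabilityThreshold (MeanFieldCircle.hkKernel R) Ks ∧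
          Kc < Ks ∧
          ¬ MeanFieldCircle.IsContinuousTransition (MeanFieldCircle.hkKernel R) Kc) ∧
      (∀ R : ℝ, Rs ≤ R → R ≤ Real.pi →
        ∃ Kc Ks : ℝ,
          MeanFieldCircle.IsCriticalCoupling (MeanFieldCircle.hkKernel R) Kc ∧
          MeanFieldCircle.IsLinearStabilityThreshold (MeanFieldCircle.hkKernel R) Ks ∧
          Kc = Ks ∧
          MeanFieldCircle.IsContinuousTransition (MeanFieldCircle.hkKernel R) Kc) := by
  open MeanFieldCircle in
  obtain ⟨Rs, h74, hpi, hroot, hlt, hgt⟩ := exists_root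
  refine ⟨Rs, ⟨⟨by linarith, hpi, hroot⟩, fun r h0 h1 hr => ?_⟩, fun R h0 hR => ?_,
    fun R hR hRpi => ?_⟩
  · rcases lt_trichotomy r Rs with h | h | h
    · exact absurd hr (hlt r h0 h).ne
    · exact h
    · exact absurd hr (hgt r h h1.le).ne'
  · have hRpi : R ≤ Real.pi := (hR.trans hpi).le
    obtain ⟨Kc, hKc⟩ := exists_isCriticalCoupling_hkKernel h0 hRpi
    obtain ⟨h1, h2⟩ := hkKernel_discontinuous h0 hRpi (hlt R h0 hR) hKc
    exact ⟨Kc, _, hKc, isLinearStabilityThreshold_hkKernel h0 hRpi, h1, h2⟩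
  · have h0 : 0 < R := by linarith
    have hle : Real.sin R * (2 - Real.cos R) ≤ R := by
      rcases hR.eq_or_lt with rfl | h
      · exact hroot.ge
      · exact (hgt R h hRpi).le
    obtain ⟨Kc, hKc⟩ := exists_isCriticalCoupling_hkKernel h0 hRpi
    obtain ⟨h1, h2⟩ := hkKernel_continuous (by linarith) hRpi hle hKc
    exact ⟨Kc, _, hKc, isLinearStabilityThreshold_hkKernel h0 hRpi, h1, h2⟩
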